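/- Let $m,n,k$ be positive integers with $k<\min\{m,n\}$, let $\mathbb{R}^{m\times n}$ carry the Frobenius inner product $\langle A,B\rangle_{\mathrm F}=\operatorname{tr}(A^\top B)$ with norm $\|\cdot\|=\|\cdot\|_{\mathrm F}$, and let $\mathcal M_k=\{X\in\mathbb{R}^{m\times n}:\operatorname{rank}X=k\}$, an embedded Riemannian submanifold of $\mathbb{R}^{m\times n}$. Let $f:\mathbb{R}^{m\times n}\to\mathbb{R}$ be differentiable, $\lambda$-smooth (that is, $\|\nabla f(X)-\nabla f(Y)\|\le\lambda\|X-Y\|$ for all $X,Y$) and strongly convex (that is, for some $\mu>0$, $f(Y)\ge f(X)+\langle\nabla f(X),Y-X\rangle_{\mathrm F}+\frac{\mu}{2}\|Y-X\|^2$ for all $X,Y$). Let $(U_\ell,V_\ell)_{\ell\ge0}$, $U_\ell\in\mathbb{R}^{m\times k}$, $V_\ell\in\mathbb{R}^{n\times k}$, be generated by the alternating least squares (ALS) method from arbitrary $U_0,V_0$: for $\ell=0,1,2,\dots$, (i) let $Q_\ell$ be a QR-factor of $V_\ell$ (a matrix with orthonormal columns such that $V_\ell=Q_\ell R$ with $R\in\mathbb{R}^{k\times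 k}$ upper triangular); (ii) choose $W_{\ell+1}\in\operatorname{argmin}_{U\in\mathbb{R}^{m\times k}}f(UQ_\ell^\top)$; (iii) let $U_{\ell+1}$ be a QR-factor of $W_{\ell+1}$; (iv) choose $V_{\ell+1}\in\operatorname{argmin}_{V\in\mathbb{R}^{n\times k}}f(U_{\ell+1}V^\top)$. Put $X_\ell=U_\ell V_\ell^\top$. Assume that $(X_\ell)$ has an accumulation point $X_*$ of rank $k$ such that $f$ is twice continuously differentiable in a neighborhood of $X_*$ and the Riemannian Hessian $H(X_*)$ of $f|_{\mathcal M_k}$ at $X_*$ is positive definite on the tangent space $T_{X_*}\mathcal M_k$. Here $H(X)[\xi]=P_{X}\big(\mathrm D\operatorname{grad}f(X)[\xi]\big)$ for $\xi\in T_X\mathcal M_k$, where $P_X$ is the orthogonal projection onto $T_X\mathcal M_k$, $\operatorname{grad}f(X)=P_X(\nabla f(X))$ for $X\in\mathcal M_k$, and $\mathrm D$ is the derivative along $\mathcal M_k$. Write $X_*=U_*S_*V_*^\top$ with $U_*^\top U_*=V_*^\top V_*=I_k$ and $S_*\in\mathbb{R}^{k\times k}$, and put $\mathcal P_{V_*}(Z)=ZV_*V_*^\top$,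 $\mathcal P_{U_*}(Z)=U_*U_*^\top Z$. Let $\lambda^*_{\min}$ be the smallest eigenvalue of $H(X_*)$, and let $\lambda^*$ be the maximum of the operator norms (induced by the Frobenius norm) of $\mathcal P_{V_*}\nabla^2f(X_*)\mathcal P_{V_*}$ and $\mathcal P_{U_*}\nabla^2f(X_*)\mathcal P_{U_*}$, where $\nabla^2 f(X_*)$ is the Euclidean Hessian. Then $X_\ell\to X_*$ (so $X_*$ is the unique limit point of $(X_\ell)$); $X_*$ is an isolated local minimizer of $f|_{\mathcal M_k}$, meaning that it is a local minimizer and all other points $X\in\mathcal M_k$ sufficiently close to $X_*$ satisfy $f(X)>f(X_*)$ and are not local minimizers of $f|_{\mathcal M_k}$; $f(X_\ell)\ge f(X_*)$ for all $\ell$; and the convergence is R-linear with $$\limsup_{\ell\to\infty}\|X_\ell-X_*\|^{1/\ell}\le1-\frac{\lambda^*_{\min}}{\lambda^*}<1,\qquad \limsup_{\ell\to\infty}\,[f(X_\ell)-f(X_*)]^{1/\ell}\le\Big(1-\frac{\lambda^*_{\min}}{\lambda^*}\Big)^2 .$$ -/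

import Mathlib

open Filter Topology

-- Matrices carry the Frobenius norm and the Frobenius inner product `⟪A, B⟫ = tr (Aᵀ B)`.
attribute [local instance] Matrix.frobeniusNormedAddCommGroup

namespace LowRank

/-- The topology of the Frobenius norm (it is definitionally the entrywise topology). -/
noncomputable instance frobeniusTopologicalSpace {m n : ℕ} :
    TopologicalSpace (Matrix (Fin m) (Fin n) ℝ) :=
  (Matrix.frobeniusNormedAddCommGroup :
    NormedAddCommGroup (Matrix (Fin m) (Fin n) ℝ)).toMetricSpace.toPseudoMetricSpace.toUniformSpace.toTopologicalSpace

noncomputable instance frobeniusInnerProductSpace {m n : ℕ} :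
    InnerProductSpace ℝ (Matrix (Fin m) (Fin n) ℝ) where
  __ := (Matrix.frobeniusNormedSpace : NormedSpace ℝ (Matrix (Fin m) (Fin n) ℝ))
  inner A B := (A.transpose * B).trace
  norm_sq_eq_re_inner A := by
    have h : ‖A‖ ^ 2 = ∑ i, ∑ j, A i j ^ 2 := by
      rw [Matrix.frobenius_norm_def, ← Real.sqrt_eq_rpow, Real.sq_sqrt]
      · simp
      · positivity
    rw [h, Finset.sum_comm]
    simp [Matrix.trace, Matrix.mul_apply, pow_two]
  conj_inner_symm A B := by
    simp only [conj_trivial]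
    rw [← Matrix.trace_transpose, Matrix.transpose_mul, Matrix.transpose_transpose]
  add_left A B C := by
    simp [Matrix.transpose_add, Matrix.add_mul, Matrix.trace_add]
  smul_left A B r := by
    simp [Matrix.transpose_smul, Matrix.trace_smul]

section Riemannian

variable {E : Type*} [NormedAddCommGroup E] [InnerProductSpace ℝ E] [FiniteDimensional ℝ E]

/-- The tangent space at `x` of an embedded submanifold `M` of a Euclidean space: the linear
subspace spanned by the tangent directions of `M` at `x`. -/
def tangentSpaceAt (M : Set E) (x : E) : Submodule ℝ E :=
  Submodule.span ℝ (tangentConeAt ℝ M x)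

/-- The Riemannian gradient of `f|_M` at `x` for the embedded metric: the orthogonal projection
of the Euclidean gradient onto the tangent space. -/
noncomputable def riemannianGradient (M : Set E) (f : E → ℝ) (x : E) : E :=
  (tangentSpaceAt M x).starProjection (gradient f x)

/-- The Riemannian Hessian of `f|_M` at `x` for the embedded metric: the tangent vector `ξ` is
sent to the orthogonal projection onto the tangent space of the derivative along `M`, in direction
`ξ`, of the Riemannian gradient field. (A derivative within `M` is determined in the directions
tangent to `M`, and only these are used.) -/
noncomputable def riemannianHessian (M : Set E) (f : E → ℝ) (x : E) :
    tangentSpaceAt M x →ₗ[ℝ] tangentSpaceAt M x :=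
  ((tangentSpaceAt M x).orthogonalProjectionOnto ∘L
    fderivWithin ℝ (riemannianGradient M f) M x ∘L (tangentSpaceAt M x).subtypeL).toLinearMap

/-- A linear operator `H` on a space of tangent vectors is positive definite. -/
def IsPosDef {T : Submodule ℝ E} (H : T →ₗ[ℝ] T) : Prop :=
  ∀ ξ : T, ξ ≠ 0 → 0 < inner ℝ (H ξ) ξ

/-- `f` is `lam`-smooth: differentiable with `lam`-Lipschitz gradient. -/
def IsSmooth (lam : ℝ) (f : E → ℝ) : Prop :=
  0 ≤ lam ∧ Differentiable ℝ f ∧ ∀ x y, ‖gradient f x - gradient f y‖ ≤ lam * ‖x - y‖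

/-- `f` (assumed differentiable) is strongly convex. -/
def IsStronglyConvex (f : E → ℝ) : Prop :=
  ∃ μ : ℝ, 0 < μ ∧ ∀ x y,
    f x + inner ℝ (gradient f x) (y - x) + μ / 2 * ‖y - x‖ ^ 2 ≤ f y

/-- The Euclidean Hessian, as a linear operator. -/
noncomputable def euclideanHessian (f : E → ℝ) (x : E) : E →L[ℝ] E :=
  fderiv ℝ (gradient f) x

/-- `x` is an isolated local minimizer of `f|_S`: it is a local minimizer, and all other points of
`S` near `x` have a strictly larger function value and are not local minimizers of `f|_S`. -/
def IsIsolatedLocalMinOn (f : E → ℝ) (S : Set E) (x : E) : Prop :=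
  x ∈ S ∧ IsLocalMinOn f S x ∧
    ∀ᶠ y in 𝓝[S \ {x}] x, f x < f y ∧ ¬ IsLocalMinOn f S y

end Riemannian

/-- The manifold of `m × n` matrices of rank exactly `k`. -/
def fixedRank (m n k : ℕ) : Set (Matrix (Fin m) (Fin n) ℝ) := {X | X.rank = k}

/-- `Z ↦ Z V Vᵀ`; for `V` with orthonormal columns, the orthogonal projection onto
`{L Vᵀ : L ∈ ℝ^{m × k}}`. -/
noncomputable def projV {n k : ℕ} (m : ℕ) (V : Matrix (Fin n) (Fin k) ℝ) :
    Matrix (Fin m) (Fin n) ℝ →L[ℝ] Matrix (Fin m) (Fin n) ℝ :=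
  LinearMap.toContinuousLinearMap
    { toFun := fun Z => Z * (V * V.transpose)
      map_add' := fun Z W => Matrix.add_mul Z W _
      map_smul' := fun c Z => Matrix.smul_mul c Z _ }

/-- `Z ↦ U Uᵀ Z`; for `U` with orthonormal columns, the orthogonal projection onto
`{U Rᵀ : R ∈ ℝ^{n × k}}`. -/
noncomputable def projU {m k : ℕ} (n : ℕ) (U : Matrix (Fin m) (Fin k) ℝ) :
    Matrix (Fin m) (Fin n) ℝ →L[ℝ] Matrix (Fin m) (Fin n) ℝ :=
  LinearMap.toContinuousLinearMap
    { toFun := fun Z => (U * U.transpose) * Z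
      map_add' := fun Z W => Matrix.mul_add _ Z W
      map_smul' := fun c Z => Matrix.mul_smul _ c Z }

/-- The maximum of the operator norms (induced by the Frobenius norm) of the two projected
Euclidean Hessians `P_V ∇²f(X) P_V` and `P_U ∇²f(X) P_U`. -/
noncomputable def projectedHessianNorm {m n k : ℕ} (f : Matrix (Fin m) (Fin n) ℝ → ℝ)
    (U : Matrix (Fin m) (Fin k) ℝ) (V : Matrix (Fin n) (Fin k) ℝ)
    (X : Matrix (Fin m) (Fin n) ℝ) : ℝ :=
  max ‖projV m V ∘L euclideanHessian f X ∘L projV m V‖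
    ‖projU n U ∘L euclideanHessian f X ∘L projU n U‖

/-- `Q` is a QR-factor of `Y`: it has orthonormal columns and `Y = Q R` with `R` upper triangular.
(It need not be unique.) -/
def IsQRFactor {p k : ℕ} (Y Q : Matrix (Fin p) (Fin k) ℝ) : Prop :=
  Q.transpose * Q = 1 ∧ ∃ R : Matrix (Fin k) (Fin k) ℝ, R.BlockTriangular id ∧ Y = Q * R

/-- `(U ℓ, V ℓ)` are iterates of the alternating least squares method for `f`, started from
arbitrary `U 0`, `V 0`. In step `ℓ`, a QR-factor `Q` of `V ℓ` is taken, `U ↦ f (U Qᵀ)` is globally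
minimized, the minimizer `W` is replaced with a QR-factor `U (ℓ + 1)`, and `V (ℓ + 1)` is a global
minimizer of `V ↦ f (U (ℓ + 1) Vᵀ)`. -/
def IsALS {m n k : ℕ} (f : Matrix (Fin m) (Fin n) ℝ → ℝ)
    (U : ℕ → Matrix (Fin m) (Fin k) ℝ) (V : ℕ → Matrix (Fin n) (Fin k) ℝ) : Prop :=
  ∀ ℓ, ∃ (Q : Matrix (Fin n) (Fin k) ℝ) (W : Matrix (Fin m) (Fin k) ℝ),
    IsQRFactor (V ℓ) Q ∧
    (∀ A : Matrix (Fin m) (Fin k) ℝ, f (W * Q.transpose) ≤ f (A * Q.transpose)) ∧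
    IsQRFactor W (U (ℓ + 1)) ∧
    ∀ B : Matrix (Fin n) (Fin k) ℝ,
      f (U (ℓ + 1) * (V (ℓ + 1)).transpose) ≤ f (U (ℓ + 1) * B.transpose)

end LowRank

/-! Each ALS half-step minimizes `f` exactly over a linear subspace, the range of an orthogonal
projection `P j`, which contains both the old and the new point; the half-steps form a sequence `z`
with `z (2 * ℓ) = X ℓ`. Optimality gives `P j (∇f (z (j + 1))) = 0`. With strong convexity the
decrease of `f` controls the squared step, so steps tend to zero, and by smoothness so does `P j (∇f
(z j))`. Near `Xs` the projections are Lipschitz-close to those onto the row and column space of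
`Xs` (`norm_sub_idem_le`), so both of these annihilate `∇f Xs` and `Xs` is critical on the manifold.

At a critical point the Riemannian Hessian is the second derivative of `f ∘ ρ` on tangent vectors,
for any local `C²` retraction `ρ`. Its positivity yields quadratic growth, which traps the sequence
near `Xs` and forces convergence, and a Polyak–Łojasiewicz inequality `‖grad f‖² ≥ 2κ (f - f Xs)`
for every `κ < l`, the smallest eigenvalue.

For the rate, exact minimization does at least as well as a gradient step inside the range of `P j`,
which gains nearly `‖P j ∇f‖² / (2Λ)` (`local_descent`). Since `P (j - 1)` annihilates the current
gradient, `‖P j ∇f‖` dominates the Riemannian gradient (`norm_riemannianGradient_le`). Hence every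
half-step contracts `f - f Xs` by any factor above `1 - l / Λ`; a full step squares this, and growth
turns values into distances by a square root. -/

namespace LowRank

/-! ### Second-order Taylor estimate and local retractions. -/

section Abstract

variable {E : Type*} [NormedAddCommGroup E] [InnerProductSpace ℝ E] [FiniteDimensional ℝ E]

omit [FiniteDimensional ℝ E] in
/-- A second-order Taylor estimate, uniform in both points, for a `C²` function. -/
theorem taylor_two_uniform {F : E → ℝ} {x₀ : E} (hF : ContDiffAt ℝ 2 F x₀) {ε : ℝ} (hε : 0 < ε) :
    ∃ δ > 0, ∀ x ∈ Metric.ball x₀ δ, ∀ y ∈ Metric.ball x₀ δ,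
      |F y - F x - fderiv ℝ F x (y - x) - 2⁻¹ * fderiv ℝ (fderiv ℝ F) x₀ (y - x) (y - x)|
        ≤ ε * ‖y - x‖ ^ 2 := by
  set A := fderiv ℝ (fderiv ℝ F) x₀ with hA
  have hsymm : ∀ v w, A v w = A w v := hF.isSymmSndFDerivAt (by simp)
  -- Strict differentiability controls `F' z - F' x - A (z - x)` with both points free; this gives
  -- uniformity in `x`. That difference is the derivative of the remainder `r` below, so the mean
  -- value inequality concludes.
  have hstrict : HasStrictFDerivAt (fderiv ℝ F) A x₀ :=
    (hF.fderiv_right (m := 1) (by norm_num)).hasStrictFDerivAt (by norm_num)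
  have h1 := hstrict.isLittleO.bound hε
  have h2 : ∀ᶠ y in 𝓝 x₀, DifferentiableAt ℝ F y := by
    filter_upwards [hF.eventually (by norm_num)] with y hy using hy.differentiableAt (by norm_num)
  rw [nhds_prod_eq] at h1
  obtain ⟨δ, hδ, h⟩ := (Metric.nhds_basis_ball.prod_self.eventually_iff).1
    (h1.and (h2.prod_inl (𝓝 x₀)))
  refine ⟨δ, hδ, fun x hx y hy => ?_⟩
  set r : E → ℝ := fun z => F z - fderiv ℝ F x z - 2⁻¹ * A (z - x) (z - x) with hr
  have hseg : segment ℝ x y ⊆ Metric.ball x₀ δ := (convex_ball x₀ δ).segment_subset hx hy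
  have hder : ∀ z ∈ segment ℝ x y,
      HasFDerivWithinAt r (fderiv ℝ F z - fderiv ℝ F x - A (z - x)) (segment ℝ x y) z := by
    intro z hz
    have hFz : HasFDerivAt F (fderiv ℝ F z) z :=
      (h (x := (z, x)) ⟨hseg hz, hx⟩).2.hasFDerivAt
    have hsub : HasFDerivAt (fun z : E => z - x) (ContinuousLinearMap.id ℝ E) z :=
      (hasFDerivAt_id z).sub_const x
    have hq : HasFDerivAt (fun z : E => A (z - x) (z - x))
        ((A (z - x)).comp (ContinuousLinearMap.id ℝ E) +
          (A.comp (ContinuousLinearMap.id ℝ E)).flip (z - x)) z :=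
      (A.hasFDerivAt.comp z hsub).clm_apply hsub
    have := ((hFz.sub (fderiv ℝ F x).hasFDerivAt).sub (hq.const_mul (2⁻¹ : ℝ))).hasFDerivWithinAt
      (s := segment ℝ x y)
    refine this.congr_fderiv ?_
    ext v
    have := hsymm v (z - x)
    simp only [map_sub, sub_apply] at this
    simp
    linarith
  have hbd : ∀ z ∈ segment ℝ x y, ‖fderiv ℝ F z - fderiv ℝ F x - A (z - x)‖ ≤ ε * ‖y - x‖ := by
    intro z hz
    refine ((h (x := (z, x)) ⟨hseg hz, hx⟩).1).trans ?_
    gcongr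
    simpa [norm_sub_rev] using norm_sub_le_of_mem_segment hz
  have := (convex_segment x y).norm_image_sub_le_of_norm_hasFDerivWithin_le hder hbd
    (left_mem_segment ℝ x y) (right_mem_segment ℝ x y)
  have e : r y - r x = F y - F x - fderiv ℝ F x (y - x) - 2⁻¹ * A (y - x) (y - x) := by
    simp [hr]; ring
  rw [e, Real.norm_eq_abs] at this
  calc _ ≤ _ := this
    _ = _ := by ring

/-- `ρ` is, near `x`, a `C²` retraction onto `M`. -/
structure IsLocalRetraction (M : Set E) (ρ : E → E) (x : E) : Prop where
  contDiffAt : ContDiffAt ℝ 2 ρ x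
  mem : ∀ᶠ y in 𝓝 x, ρ y ∈ M
  eq_self : ∀ᶠ y in 𝓝 x, y ∈ M → ρ y = y

namespace IsLocalRetraction

variable {M : Set E} {ρ : E → E} {x : E}

omit [FiniteDimensional ℝ E] in
theorem eventually (h : IsLocalRetraction M ρ x) : ∀ᶠ y in 𝓝 x, IsLocalRetraction M ρ y := by
  filter_upwards [h.contDiffAt.eventually (by norm_num), h.mem.eventually_nhds,
    h.eq_self.eventually_nhds] with y h1 h2 h3 using ⟨h1, h2, h3⟩

omit [FiniteDimensional ℝ E] in
theorem hasFDerivAt (h : IsLocalRetraction M ρ x) : HasFDerivAt ρ (fderiv ℝ ρ x) x :=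
  (h.contDiffAt.differentiableAt (by norm_num)).hasFDerivAt

-- `ρ` sends a whole neighbourhood, whose tangent cone is everything, into `M`, and derivatives map
-- tangent cones to tangent cones.
omit [FiniteDimensional ℝ E] in
theorem fderiv_mem (h : IsLocalRetraction M ρ x) (hx : x ∈ M) (v : E) :
    fderiv ℝ ρ x v ∈ tangentSpaceAt M x := by
  apply Submodule.subset_span
  obtain ⟨s, hs, hsM⟩ := h.mem.exists_mem
  have hv : v ∈ tangentConeAt ℝ s x := by rw [tangentConeAt_of_mem_nhds hs]; trivial
  have := (h.hasFDerivAt.hasFDerivWithinAt (s := s)).mapsTo_tangent_cone hv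
  rw [h.eq_self.self_of_nhds hx] at this
  exact tangentConeAt_mono (by rintro _ ⟨y, hy, rfl⟩; exact hsM y hy) this

-- `ρ` and the identity agree on `M`, so their derivatives agree on the tangent cone and hence on
-- its span.
omit [FiniteDimensional ℝ E] in
theorem fderiv_eq_self (h : IsLocalRetraction M ρ x) (hx : x ∈ M) {ξ : E}
    (hξ : ξ ∈ tangentSpaceAt M x) : fderiv ℝ ρ x ξ = ξ := by
  have h1 : HasFDerivWithinAt ρ (fderiv ℝ ρ x) M x := h.hasFDerivAt.hasFDerivWithinAt
  have h2 : HasFDerivWithinAt ρ (ContinuousLinearMap.id ℝ E) M x := by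
    refine (hasFDerivWithinAt_id x M).congr_of_eventuallyEq ?_ (h.eq_self.self_of_nhds hx)
    filter_upwards [nhdsWithin_le_nhds h.eq_self, self_mem_nhdsWithin] with y h1 h2 using h1 h2
  have h3 := h1.unique_on h2
  exact LinearMap.eqOn_span (f := (fderiv ℝ ρ x).toLinearMap) (g := LinearMap.id)
    (fun y hy => h3 hy) hξ

end IsLocalRetraction

theorem inner_riemannianGradient {M : Set E} {f : E → ℝ} {x ζ : E}
    (hζ : ζ ∈ tangentSpaceAt M x) :
    inner ℝ (riemannianGradient M f x) ζ = inner ℝ (gradient f x) ζ := by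
  rw [riemannianGradient, Submodule.inner_starProjection_left_eq_right,
    Submodule.starProjection_eq_self_iff.2 hζ]

/-! ### Riemannian gradient and Hessian through a retraction. -/

section Local

variable {M : Set E} {ρ : E → E} {x₀ : E} {f : E → ℝ}

theorem fderiv_comp_retraction (hf : Differentiable ℝ f) {x : E}
    (hρ : IsLocalRetraction M ρ x) (hx : x ∈ M) (v : E) :
    fderiv ℝ (f ∘ ρ) x v = inner ℝ (riemannianGradient M f x) (fderiv ℝ ρ x v) := by
  rw [inner_riemannianGradient (hρ.fderiv_mem hx v), inner_gradient_left,
    fderiv_comp x hf.differentiableAt hρ.hasFDerivAt.differentiableAt, hρ.eq_self.self_of_nhds hx]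
  rfl

theorem riemannianGradient_eq_zero_of_isLocalMinOn (hρ : IsLocalRetraction M ρ x₀) (hx : x₀ ∈ M)
    (hf : Differentiable ℝ f) (hmin : IsLocalMinOn f M x₀) : riemannianGradient M f x₀ = 0 := by
  have hx' := hρ.eq_self.self_of_nhds hx
  have h1 : IsLocalMin (f ∘ ρ) x₀ := by
    have ht : Tendsto ρ (𝓝 x₀) (𝓝[M] x₀) := tendsto_nhdsWithin_iff.2
      ⟨by simpa only [hx'] using hρ.contDiffAt.continuousAt.tendsto, hρ.mem⟩
    filter_upwards [ht.eventually hmin] with y hy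
    simpa [hx'] using hy
  have hm : riemannianGradient M f x₀ ∈ tangentSpaceAt M x₀ := Submodule.starProjection_apply_mem _ _
  have h2 := fderiv_comp_retraction hf hρ hx (riemannianGradient M f x₀)
  rw [h1.fderiv_eq_zero, hρ.fderiv_eq_self hx hm] at h2
  simpa using h2.symm

/-- Differentiate `D(f ∘ ρ)(y) v = ⟨grad f y, Dρ(y) v⟩` along `M`: the term containing the second
derivative of `ρ` is paired with `grad f x₀ = 0` and disappears. -/
theorem fderiv_fderiv_comp_retraction (hρ : IsLocalRetraction M ρ x₀) (hx : x₀ ∈ M)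
    (hf : Differentiable ℝ f) (hC2 : ContDiffAt ℝ 2 f x₀)
    (h0 : riemannianGradient M f x₀ = 0)
    (hD : DifferentiableWithinAt ℝ (riemannianGradient M f) M x₀)
    (ξ v : tangentSpaceAt M x₀) :
    fderiv ℝ (fderiv ℝ (f ∘ ρ)) x₀ ξ v = inner ℝ (riemannianHessian M f x₀ ξ) v := by
  have hx' := hρ.eq_self.self_of_nhds hx
  have hg : ContDiffAt ℝ 2 (f ∘ ρ) x₀ :=
    ContDiffAt.comp x₀ (by rwa [hx']) hρ.contDiffAt
  have d1 : HasFDerivAt (fderiv ℝ (f ∘ ρ)) (fderiv ℝ (fderiv ℝ (f ∘ ρ)) x₀) x₀ :=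
    ((hg.fderiv_right (m := 1) (by norm_num)).differentiableAt (by norm_num)).hasFDerivAt
  have d2 : HasFDerivAt (fderiv ℝ ρ) (fderiv ℝ (fderiv ℝ ρ) x₀) x₀ :=
    ((hρ.contDiffAt.fderiv_right (m := 1) (by norm_num)).differentiableAt
      (by norm_num)).hasFDerivAt
  have e1 := (d1.clm_apply (hasFDerivAt_const (v : E) x₀)).hasFDerivWithinAt (s := M)
  have e2 := hD.hasFDerivWithinAt.inner ℝ
    ((d2.clm_apply (hasFDerivAt_const (v : E) x₀)).hasFDerivWithinAt (s := M))
  have e3 : (fun y => fderiv ℝ (f ∘ ρ) y (v : E)) =ᶠ[𝓝[M] x₀]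
      fun y => inner ℝ (riemannianGradient M f y) (fderiv ℝ ρ y (v : E)) := by
    filter_upwards [nhdsWithin_le_nhds hρ.eventually, self_mem_nhdsWithin] with y h1 h2
      using fderiv_comp_retraction hf h1 h2 v
  have e4 := e1.unique_on (e2.congr_of_eventuallyEq e3 (fderiv_comp_retraction hf hρ hx v))
  have e5 := LinearMap.eqOn_span
    (f := ContinuousLinearMap.toLinearMap _) (g := ContinuousLinearMap.toLinearMap _)
    (fun y hy => e4 hy) ξ.2
  simp [h0, fderivInnerCLM_apply, hρ.fderiv_eq_self hx v.2] at e5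
  rw [e5]
  simp [riemannianHessian]

theorem riemannianHessian_isSymmetric (hρ : IsLocalRetraction M ρ x₀) (hx : x₀ ∈ M)
    (hf : Differentiable ℝ f) (hC2 : ContDiffAt ℝ 2 f x₀)
    (h0 : riemannianGradient M f x₀ = 0)
    (hD : DifferentiableWithinAt ℝ (riemannianGradient M f) M x₀) :
    (riemannianHessian M f x₀).IsSymmetric := by
  intro ξ v
  have hg : ContDiffAt ℝ 2 (f ∘ ρ) x₀ :=
    ContDiffAt.comp x₀ (by rwa [hρ.eq_self.self_of_nhds hx]) hρ.contDiffAt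
  have hs : IsSymmSndFDerivAt ℝ (f ∘ ρ) x₀ := hg.isSymmSndFDerivAt (by simp)
  rw [← fderiv_fderiv_comp_retraction hρ hx hf hC2 h0 hD, hs,
    fderiv_fderiv_comp_retraction hρ hx hf hC2 h0 hD, real_inner_comm]

omit [FiniteDimensional ℝ E] in
/-- The smallest eigenvalue of a symmetric positive definite operator. -/
theorem exists_isLeast_eigenvalue {T : Submodule ℝ E} [FiniteDimensional ℝ T] [Nontrivial T]
    {H : T →ₗ[ℝ] T} (hs : H.IsSymmetric) (hpos : IsPosDef H) :
    ∃ l : ℝ, 0 < l ∧ IsLeast {μ : ℝ | Module.End.HasEigenvalue H μ} l ∧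
      ∀ ξ : T, l * ‖ξ‖ ^ 2 ≤ inner ℝ (H ξ) ξ := by
  have hpos' : ∀ {μ : ℝ} {v : T}, Module.End.HasEigenvector H μ v →
      0 < ‖v‖ ^ 2 ∧ inner ℝ (H v) v = μ * ‖v‖ ^ 2 := by
    intro μ v hv
    have := norm_pos_iff.2 hv.2
    refine ⟨by positivity, ?_⟩
    rw [hv.apply_eq_smul, real_inner_smul_left, real_inner_self_eq_norm_sq]
  have heig := hs.hasEigenvalue_iInf_of_finiteDimensional
  set l : ℝ := ⨅ x : { x : T // x ≠ 0 }, RCLike.re (inner ℝ (H x) x) / ‖(x : T)‖ ^ 2 with hl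
  have hb : BddBelow (Set.range fun x : { x : T // x ≠ 0 } =>
      RCLike.re (inner ℝ (H x) x) / ‖(x : T)‖ ^ 2) := by
    refine ⟨0, ?_⟩
    rintro _ ⟨x, rfl⟩
    exact div_nonneg (hpos x x.2).le (by positivity)
  have hle : ∀ ξ : T, l * ‖ξ‖ ^ 2 ≤ inner ℝ (H ξ) ξ := by
    intro ξ
    by_cases h : ξ = 0
    · simp [h]
    · have h1 := ciInf_le hb ⟨ξ, h⟩
      have : 0 < ‖ξ‖ := norm_pos_iff.2 h
      exact (le_div_iff₀ (by positivity)).1 h1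
  refine ⟨l, ?_, ⟨heig, ?_⟩, hle⟩
  · obtain ⟨v, hv⟩ := heig.exists_hasEigenvector
    have h1 := hpos v hv.2
    obtain ⟨h2, h3⟩ := hpos' hv
    rw [h3] at h1
    exact pos_of_mul_pos_left h1 h2.le
  · rintro μ hμ
    obtain ⟨v, hv⟩ := Module.End.HasEigenvalue.exists_hasEigenvector hμ
    obtain ⟨h2, h3⟩ := hpos' hv
    have h4 := hle v
    rw [h3] at h4
    exact le_of_mul_le_mul_right h4 h2

/-- Without differentiability `fderivWithin` takes its default value `0`, and the zero form is not
positive on a nonzero tangent vector. -/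
theorem differentiableWithinAt_of_isPosDef [Nontrivial (tangentSpaceAt M x₀)]
    (hpos : IsPosDef (riemannianHessian M f x₀)) :
    DifferentiableWithinAt ℝ (riemannianGradient M f) M x₀ := by
  by_contra h
  obtain ⟨ξ, hξ⟩ := exists_ne (0 : tangentSpaceAt M x₀)
  have := hpos ξ hξ
  simp [riemannianHessian, fderivWithin_zero_of_not_differentiableWithinAt h] at this

/-! ### Local expansions, quadratic growth and gradient domination. -/

/-- The tangential displacement of `x` from `x₀`, measured with the retraction `ρ`. -/
noncomputable def tangentPart (hρ : IsLocalRetraction M ρ x₀) (hx : x₀ ∈ M) (x : E) :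
    tangentSpaceAt M x₀ :=
  ⟨fderiv ℝ ρ x₀ (x - x₀), hρ.fderiv_mem hx _⟩

-- Both `x` and `x₀` are fixed by `ρ`, so this is the first-order expansion of `ρ` itself.
omit [FiniteDimensional ℝ E] in
theorem sub_tangentPart_le (hρ : IsLocalRetraction M ρ x₀) (hx : x₀ ∈ M) {ε : ℝ} (hε : 0 < ε) :
    ∀ᶠ x in 𝓝[M] x₀, ‖x - x₀ - tangentPart hρ hx x‖ ≤ ε * ‖x - x₀‖ := by
  filter_upwards [nhdsWithin_le_nhds (hρ.hasFDerivAt.isLittleO.bound hε),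
    nhdsWithin_le_nhds hρ.eq_self, self_mem_nhdsWithin] with x h1 h2 h3
  rwa [h2 h3, hρ.eq_self.self_of_nhds hx] at h1

omit [FiniteDimensional ℝ E] in
theorem local_norm_tangentPart (hρ : IsLocalRetraction M ρ x₀) (hx : x₀ ∈ M) :
    ∀ᶠ x in 𝓝[M] x₀, ‖x - x₀‖ ≤ 2 * ‖tangentPart hρ hx x‖ ∧
      ‖tangentPart hρ hx x‖ ≤ 2 * ‖x - x₀‖ := by
  filter_upwards [sub_tangentPart_le hρ hx (ε := 1 / 2) (by norm_num)] with x h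
  have h1 := norm_sub_norm_le (x - x₀) (tangentPart hρ hx x)
  have h2 := norm_sub_norm_le (tangentPart hρ hx x : E) (x - x₀)
  rw [norm_sub_rev (_ : E) (x - x₀)] at h2
  simp only [Submodule.coe_norm] at *
  constructor <;> linarith

/-- Second-order expansion of `f` along `M` at a critical point. -/
theorem local_expansion_value (hρ : IsLocalRetraction M ρ x₀) (hx : x₀ ∈ M)
    (hf : Differentiable ℝ f) (hC2 : ContDiffAt ℝ 2 f x₀)
    (h0 : riemannianGradient M f x₀ = 0)
    (hD : DifferentiableWithinAt ℝ (riemannianGradient M f) M x₀) {ε : ℝ} (hε : 0 < ε) :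
    ∀ᶠ x in 𝓝[M] x₀, |f x - f x₀ - 2⁻¹ * inner ℝ
      (riemannianHessian M f x₀ (tangentPart hρ hx x)) (tangentPart hρ hx x)|
        ≤ ε * ‖tangentPart hρ hx x‖ ^ 2 := by
  have hx' := hρ.eq_self.self_of_nhds hx
  have hg : ContDiffAt ℝ 2 (f ∘ ρ) x₀ :=
    ContDiffAt.comp x₀ (by rwa [hx']) hρ.contDiffAt
  set B := fderiv ℝ (fderiv ℝ (f ∘ ρ)) x₀ with hB
  obtain ⟨δ, hδ, ht⟩ := taylor_two_uniform hg (ε := ε / 8) (by positivity)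
  -- Ensures `‖B‖ η ≤ ε / 8`, also for `B = 0`. With `‖d‖ ≤ 2 ‖ξ‖`, passing from `d` to `ξ` costs
  -- `3ε/8` and the Taylor error `4ε/8`, in units of `‖ξ‖²`.
  set η := ε / (8 * (‖B‖ + 1)) with hη
  have hηpos : 0 < η := by positivity
  filter_upwards [nhdsWithin_le_nhds (Metric.ball_mem_nhds x₀ hδ), nhdsWithin_le_nhds hρ.eq_self,
    self_mem_nhdsWithin, sub_tangentPart_le hρ hx hηpos, local_norm_tangentPart hρ hx]
    with x h1 h2 h3 h4 h5
  rw [← fderiv_fderiv_comp_retraction hρ hx hf hC2 h0 hD]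
  have h6 := ht x₀ (Metric.mem_ball_self hδ) x h1
  rw [fderiv_comp_retraction hf hρ hx, h0, inner_zero_left, sub_zero] at h6
  simp only [Function.comp, h2 h3, hx'] at h6
  rw [← hB] at h6 ⊢
  set d := x - x₀
  set ξ := tangentPart hρ hx x
  have h7 : B d d - B ξ ξ = B (d - ξ) d + B ξ (d - ξ) := by simp
  have h8 : |B d d - B ξ ξ| ≤ ‖B‖ * (η * ‖d‖) * ‖d‖ + ‖B‖ * ‖ξ‖ * (η * ‖d‖) := by
    rw [h7]
    refine (abs_add_le _ _).trans (add_le_add ?_ ?_)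
    · refine (B.le_opNorm₂ _ _).trans ?_
      gcongr
    · refine (B.le_opNorm₂ _ _).trans ?_
      gcongr
      rfl
  have hBη : ‖B‖ * η ≤ ε / 8 := by
    rw [hη, mul_div_assoc', div_le_div_iff₀ (by positivity) (by positivity)]
    nlinarith [norm_nonneg B]
  have hξ := norm_nonneg ξ
  have hd := norm_nonneg d
  have h9 : ‖B‖ * (η * ‖d‖) * ‖d‖ + ‖B‖ * ‖ξ‖ * (η * ‖d‖) ≤ ε / 8 * (6 * ‖ξ‖ ^ 2) := by
    calc _ = (‖B‖ * η) * (‖d‖ * ‖d‖ + ‖ξ‖ * ‖d‖) := by ring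
      _ ≤ ε / 8 * ((2 * ‖ξ‖) * (2 * ‖ξ‖) + ‖ξ‖ * (2 * ‖ξ‖)) := by
        gcongr <;> exact h5.1
      _ = _ := by ring
  have h10 : ε / 8 * ‖d‖ ^ 2 ≤ ε / 8 * (4 * ‖ξ‖ ^ 2) := by
    have : ‖d‖ ^ 2 ≤ (2 * ‖ξ‖) ^ 2 := by gcongr; exact h5.1
    gcongr
    linarith
  have h11 := h8.trans h9
  have h12 := h6.trans h10
  have h13 : 0 ≤ ε * ‖ξ‖ ^ 2 := by positivity
  rw [abs_le] at h11 h12 ⊢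
  constructor <;> linarith [h11.1, h11.2, h12.1, h12.2]

/-- First-order expansion of the Riemannian gradient along `M` at a critical point. -/
theorem local_expansion_gradient (hρ : IsLocalRetraction M ρ x₀) (hx : x₀ ∈ M)
    (h0 : riemannianGradient M f x₀ = 0)
    (hD : DifferentiableWithinAt ℝ (riemannianGradient M f) M x₀) {ε : ℝ} (hε : 0 < ε) :
    ∀ᶠ x in 𝓝[M] x₀, inner ℝ
      (riemannianHessian M f x₀ (tangentPart hρ hx x)) (tangentPart hρ hx x)
        - ε * ‖tangentPart hρ hx x‖ ^ 2 ≤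
      ‖riemannianGradient M f x‖ * ‖tangentPart hρ hx x‖ := by
  set D := fderivWithin ℝ (riemannianGradient M f) M x₀ with hDdef
  set η := ε / (4 * (‖D‖ + 1)) with hη
  have hηpos : 0 < η := by positivity
  filter_upwards [hD.hasFDerivWithinAt.isLittleO.bound (c := ε / 4) (by positivity),
    sub_tangentPart_le hρ hx hηpos, local_norm_tangentPart hρ hx] with x h1 h4 h5
  rw [h0, sub_zero, ← hDdef] at h1
  set d := x - x₀
  set ξ := tangentPart hρ hx x
  set G := riemannianGradient M f x
  have e1 : inner ℝ (riemannianHessian M f x₀ ξ) ξ = inner ℝ (D ξ) (ξ : E) := by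
    simp [riemannianHessian, D]
  have e2 : inner ℝ (D ξ) (ξ : E) = inner ℝ G (ξ : E) - inner ℝ (G - D d) (ξ : E)
      - inner ℝ (D (d - ξ)) (ξ : E) := by
    simp only [map_sub, inner_sub_left]; ring
  have hBη : ‖D‖ * η ≤ ε / 4 := by
    rw [hη, mul_div_assoc', div_le_div_iff₀ (by positivity) (by positivity)]
    nlinarith [norm_nonneg D]
  have hξ := norm_nonneg ξ
  have b1 : inner ℝ G (ξ : E) ≤ ‖G‖ * ‖ξ‖ := real_inner_le_norm _ _
  have b2 : |inner ℝ (G - D d) (ξ : E)| ≤ ε / 4 * (2 * ‖ξ‖) * ‖ξ‖ := by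
    refine (abs_real_inner_le_norm _ _).trans ?_
    gcongr
    · exact h1.trans (by gcongr; exact h5.1)
    · rfl
  have b3 : |inner ℝ (D (d - ξ)) (ξ : E)| ≤ ε / 4 * (2 * ‖ξ‖) * ‖ξ‖ := by
    refine (abs_real_inner_le_norm _ _).trans ?_
    gcongr
    · calc _ ≤ ‖D‖ * ‖d - ξ‖ := D.le_opNorm _
        _ ≤ ‖D‖ * (η * ‖d‖) := by gcongr
        _ = ‖D‖ * η * ‖d‖ := by ring
        _ ≤ ε / 4 * (2 * ‖ξ‖) := by gcongr; exact h5.1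
    · rfl
  rw [e1, e2]
  rw [abs_le] at b2 b3
  nlinarith [b2.1, b3.1]

variable {l : ℝ}

/-- The Hessian term `l / 2` minus the error `l / 4` leaves `l / 4`; `‖x - x₀‖ ≤ 2 ‖ξ‖` costs
another factor `4`. -/
theorem local_growth (hρ : IsLocalRetraction M ρ x₀) (hx : x₀ ∈ M)
    (hf : Differentiable ℝ f) (hC2 : ContDiffAt ℝ 2 f x₀)
    (h0 : riemannianGradient M f x₀ = 0)
    (hD : DifferentiableWithinAt ℝ (riemannianGradient M f) M x₀) (hl : 0 < l)
    (hH : ∀ ξ, l * ‖ξ‖ ^ 2 ≤ inner ℝ (riemannianHessian M f x₀ ξ) ξ) :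
    ∀ᶠ x in 𝓝[M] x₀, l / 16 * ‖x - x₀‖ ^ 2 ≤ f x - f x₀ := by
  filter_upwards [local_expansion_value hρ hx hf hC2 h0 hD (ε := l / 4) (by positivity),
    local_norm_tangentPart hρ hx] with x h1 h2
  have h3 := hH (tangentPart hρ hx x)
  have h4 : ‖x - x₀‖ ^ 2 ≤ (2 * ‖tangentPart hρ hx x‖) ^ 2 := by gcongr; exact h2.1
  have h5 := (abs_le.1 h1).1
  nlinarith

/-- A local Polyak–Łojasiewicz inequality on `M`. -/
theorem local_gradient_domination (hρ : IsLocalRetraction M ρ x₀) (hx : x₀ ∈ M)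
    (hf : Differentiable ℝ f) (hC2 : ContDiffAt ℝ 2 f x₀)
    (h0 : riemannianGradient M f x₀ = 0)
    (hD : DifferentiableWithinAt ℝ (riemannianGradient M f) M x₀)
    (hH : ∀ ξ, l * ‖ξ‖ ^ 2 ≤ inner ℝ (riemannianHessian M f x₀ ξ) ξ) {κ : ℝ} (hκ0 : 0 ≤ κ)
    (hκ : κ < l) :
    ∀ᶠ x in 𝓝[M] x₀, 2 * κ * (f x - f x₀) ≤ ‖riemannianGradient M f x‖ ^ 2 := by
  -- With `κ = l - 4ε` one has `κ t² ≤ q - 4ε t²`, and `(q - 4ε t²)(q + 2ε t²) ≤ (q - ε t²)²`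
  -- because the cross terms coincide.
  set ε := (l - κ) / 4 with hε
  have hεpos : 0 < ε := by rw [hε]; linarith
  filter_upwards [local_expansion_value hρ hx hf hC2 h0 hD hεpos,
    local_expansion_gradient hρ hx h0 hD hεpos] with x h1 h2
  have h3 := hH (tangentPart hρ hx x)
  have h5 := (abs_le.1 h1).2
  set t := ‖tangentPart hρ hx x‖
  set q := inner ℝ (riemannianHessian M f x₀ (tangentPart hρ hx x)) (tangentPart hρ hx x)
  set N := ‖riemannianGradient M f x‖
  have hκε : κ = l - 4 * ε := by rw [hε]; ring
  have ht : 0 ≤ t := norm_nonneg _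
  have hN : 0 ≤ N := norm_nonneg _
  rcases ht.eq_or_lt with ht0 | ht0
  · have hq : q = 0 := by
      have : tangentPart hρ hx x = 0 := norm_eq_zero.1 ht0.symm
      simp [q, this]
    rw [← ht0, hq] at h5
    have : f x - f x₀ ≤ 0 := by linarith
    nlinarith [mul_nonneg hκ0 (neg_nonneg.2 this)]
  · have hq0 : 0 ≤ q - ε * t ^ 2 := by
      have : 0 ≤ (l - ε) * t ^ 2 := mul_nonneg (by linarith) (by positivity)
      linarith
    have h6 : (q - ε * t ^ 2) ^ 2 ≤ (N * t) ^ 2 := by gcongr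
    have h7 : 2 * κ * (f x - f x₀) ≤ κ * (q + 2 * ε * t ^ 2) := by nlinarith
    have h8 : κ * (q + 2 * ε * t ^ 2) * t ^ 2 ≤ (q - ε * t ^ 2) ^ 2 := by
      have a1 : κ * t ^ 2 ≤ q - 4 * ε * t ^ 2 := by rw [hκε]; linarith
      have a2 : 0 ≤ q + 2 * ε * t ^ 2 := by nlinarith [mul_pos hεpos (pow_pos ht0 2)]
      calc _ = κ * t ^ 2 * (q + 2 * ε * t ^ 2) := by ring
        _ ≤ (q - 4 * ε * t ^ 2) * (q + 2 * ε * t ^ 2) := by gcongr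
        _ ≤ _ := by nlinarith [sq_nonneg (ε * t ^ 2)]
    have h9 : κ * (q + 2 * ε * t ^ 2) * t ^ 2 ≤ N ^ 2 * t ^ 2 := by linarith [mul_pow N t 2]
    exact h7.trans (le_of_mul_le_mul_right h9 (by positivity))

/-- Growth gives strictness. Another local minimizer nearby would be critical, and gradient
domination would then push its value down to `f x₀`. -/
theorem isIsolatedLocalMinOn_of_hessian (hρ : IsLocalRetraction M ρ x₀) (hx : x₀ ∈ M)
    (hf : Differentiable ℝ f) (hC2 : ContDiffAt ℝ 2 f x₀)
    (h0 : riemannianGradient M f x₀ = 0)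
    (hD : DifferentiableWithinAt ℝ (riemannianGradient M f) M x₀) (hl : 0 < l)
    (hH : ∀ ξ, l * ‖ξ‖ ^ 2 ≤ inner ℝ (riemannianHessian M f x₀ ξ) ξ) :
    IsIsolatedLocalMinOn f M x₀ := by
  have hg := local_growth hρ hx hf hC2 h0 hD hl hH
  refine ⟨hx, ?_, ?_⟩
  · filter_upwards [hg] with x h
    have : 0 ≤ l / 16 * ‖x - x₀‖ ^ 2 := by positivity
    linarith
  · have hle : 𝓝[M \ {x₀}] x₀ ≤ 𝓝[M] x₀ := nhdsWithin_mono _ Set.sdiff_subset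
    filter_upwards [hle hg, hle (local_gradient_domination hρ hx hf hC2 h0 hD hH
      (κ := l / 2) (by positivity) (by linarith)), nhdsWithin_le_nhds hρ.eventually,
      self_mem_nhdsWithin] with x h1 h2 h3 h4
    have hne : 0 < ‖x - x₀‖ := norm_pos_iff.2 (sub_ne_zero.2 h4.2)
    have hlt : f x₀ < f x := by
      have : 0 < l / 16 * ‖x - x₀‖ ^ 2 := by positivity
      linarith
    refine ⟨hlt, fun hmin => ?_⟩
    rw [riemannianGradient_eq_zero_of_isLocalMinOn h3 h4.1 hf hmin] at h2
    simp at h2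
    nlinarith
end Local

/-! ### Successive exact minimization over subspaces. -/

/-- `z` is generated by successive exact minimizations of `f` over the ranges of the orthogonal
projections `P j`, each range containing the current and the next iterate. -/
structure IsSubspaceMinimization (f : E → ℝ) (P : ℕ → E →L[ℝ] E) (z : ℕ → E) : Prop where
  idem : ∀ j v, P j (P j v) = P j v
  symm : ∀ j v w, inner ℝ (P j v) w = inner ℝ v (P j w)
  left : ∀ j, P j (z j) = z j
  right : ∀ j, P j (z (j + 1)) = z (j + 1)
  min : ∀ j w, P j w = w → f (z (j + 1)) ≤ f w

omit [FiniteDimensional ℝ E] in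
theorem norm_symm_idem_le {P : E →L[ℝ] E} (hi : ∀ v, P (P v) = P v)
    (hs : ∀ v w, inner ℝ (P v) w = inner ℝ v (P w)) (v : E) : ‖P v‖ ≤ ‖v‖ := by
  have h1 : ‖P v‖ * ‖P v‖ = inner ℝ v (P v) := by
    rw [← real_inner_self_eq_norm_mul_norm, hs, hi]
  have h2 : ‖P v‖ * ‖P v‖ ≤ ‖v‖ * ‖P v‖ := h1 ▸ real_inner_le_norm v (P v)
  rcases (norm_nonneg (P v)).eq_or_lt with h | h
  · rw [← h]; exact norm_nonneg v
  · exact le_of_mul_le_mul_right h2 h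

namespace IsSubspaceMinimization

variable {f : E → ℝ} {P : ℕ → E →L[ℝ] E} {z : ℕ → E} {x₀ : E}

theorem proj_gradient_eq_zero (h : IsSubspaceMinimization f P z) (hf : Differentiable ℝ f)
    (j : ℕ) : P j (gradient f (z (j + 1))) = 0 := by
  have hmin : IsLocalMin (fun v => f (z (j + 1) + P j v)) 0 := by
    refine Eventually.of_forall fun v => ?_
    simp only [map_zero, add_zero]
    exact h.min j _ (by rw [map_add, h.right, h.idem])
  have hd : HasFDerivAt (fun v => f (z (j + 1) + P j v))
      ((fderiv ℝ f (z (j + 1))).comp (P j)) 0 := by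
    have h1 : HasFDerivAt (fun v => z (j + 1) + P j v) (P j) 0 := (P j).hasFDerivAt.const_add _
    have h2 : HasFDerivAt f (fderiv ℝ f (z (j + 1))) (z (j + 1) + P j 0) := by
      simpa using (hf (z (j + 1))).hasFDerivAt
    exact h2.comp 0 h1
  have h0 := hd.fderiv ▸ hmin.fderiv_eq_zero
  set g := gradient f (z (j + 1)) with hg
  have h1 := DFunLike.congr_fun h0 g
  simp only [ContinuousLinearMap.comp_apply, zero_apply] at h1
  rw [← inner_gradient_left, ← hg, ← h.idem, ← h.symm, real_inner_self_eq_norm_sq] at h1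
  simpa using h1

omit [FiniteDimensional ℝ E] in
theorem antitone (h : IsSubspaceMinimization f P z) : Antitone (fun j => f (z j)) :=
  antitone_nat_of_succ_le fun j => h.min j _ (h.left j)

/-- In strong convexity at `z (j + 1)` the linear term vanishes: the step lies in the range of `P
j`, to which the new gradient is orthogonal. -/
theorem sq_step_le (h : IsSubspaceMinimization f P z) (hf : Differentiable ℝ f) {μ : ℝ}
    (hμ : ∀ x y, f x + inner ℝ (gradient f x) (y - x) + μ / 2 * ‖y - x‖ ^ 2 ≤ f y) (j : ℕ) :
    μ / 2 * ‖z (j + 1) - z j‖ ^ 2 ≤ f (z j) - f (z (j + 1)) := by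
  have h1 := hμ (z (j + 1)) (z j)
  have h2 : P j (z j - z (j + 1)) = z j - z (j + 1) := by rw [map_sub, h.left, h.right]
  rw [← h2, ← h.symm, h.proj_gradient_eq_zero hf, inner_zero_left, h2, norm_sub_rev] at h1
  linarith

variable {φ : ℕ → ℕ}

omit [FiniteDimensional ℝ E] in
theorem tendsto_value (h : IsSubspaceMinimization f P z) (hf : Continuous f)
    (hφ : Tendsto φ atTop atTop) (hz : Tendsto (z ∘ φ) atTop (𝓝 x₀)) :
    Tendsto (fun j => f (z j)) atTop (𝓝 (f x₀)) :=
  (tendsto_iff_tendsto_subseq_of_antitone h.antitone hφ).2 ((hf.tendsto x₀).comp hz)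

omit [FiniteDimensional ℝ E] in
theorem le_value (h : IsSubspaceMinimization f P z) (hf : Continuous f)
    (hφ : Tendsto φ atTop atTop) (hz : Tendsto (z ∘ φ) atTop (𝓝 x₀)) (j : ℕ) :
    f x₀ ≤ f (z j) :=
  h.antitone.le_of_tendsto (h.tendsto_value hf hφ hz) j

theorem tendsto_step (h : IsSubspaceMinimization f P z) (hf : Differentiable ℝ f)
    (hconv : IsStronglyConvex f)
    (hφ : Tendsto φ atTop atTop) (hz : Tendsto (z ∘ φ) atTop (𝓝 x₀)) :
    Tendsto (fun j => z (j + 1) - z j) atTop (𝓝 0) := by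
  obtain ⟨μ, hμ, hc⟩ := hconv
  have h1 := h.tendsto_value hf.continuous hφ hz
  have h2 : Tendsto (fun j => 2 / μ * (f (z j) - f (z (j + 1)))) atTop (𝓝 0) := by
    simpa using (h1.sub ((tendsto_add_atTop_iff_nat 1).2 h1)).const_mul (2 / μ)
  have h3 : Tendsto (fun j => ‖z (j + 1) - z j‖ ^ 2) atTop (𝓝 0) := by
    refine squeeze_zero (fun _ => by positivity) (fun j => ?_) h2
    have := h.sq_step_le hf hc j
    rw [div_mul_eq_mul_div, le_div_iff₀ hμ]
    linarith
  have h4 : Tendsto (fun j => ‖z (j + 1) - z j‖) atTop (𝓝 0) := by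
    simpa using h3.sqrt
  exact tendsto_zero_iff_norm_tendsto_zero.2 h4

theorem tendsto_proj_gradient (h : IsSubspaceMinimization f P z) {lam : ℝ}
    (hf : IsSmooth lam f) (hstep : Tendsto (fun j => z (j + 1) - z j) atTop (𝓝 0)) :
    Tendsto (fun j => P j (gradient f (z j))) atTop (𝓝 0) := by
  refine squeeze_zero_norm (fun j => ?_) (by simpa using hstep.norm.const_mul lam)
  have h1 : P j (gradient f (z j)) = P j (gradient f (z j) - gradient f (z (j + 1))) := by
    rw [map_sub, h.proj_gradient_eq_zero hf.2.1, sub_zero]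
  rw [h1, norm_sub_rev]
  exact (norm_symm_idem_le (h.idem j) (h.symm j) _).trans (hf.2.2 _ _)

/-- Along the subsequence `P (φ n)` converges to `S₀` in operator norm, while `P j (∇f (z j))` tends
to zero. It serves once for even and once for odd indices. -/
theorem critical_of_cluster (h : IsSubspaceMinimization f P z) {lam : ℝ}
    (hf : IsSmooth lam f) (hstep : Tendsto (fun j => z (j + 1) - z j) atTop (𝓝 0))
    (hφ : Tendsto φ atTop atTop) (hz : Tendsto (z ∘ φ) atTop (𝓝 x₀)) {S : ℕ → E →L[ℝ] E} {C : ℝ}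
    (hS : ∀ j, ‖P j - S j‖ ≤ C * ‖z j - x₀‖) {S₀ : E →L[ℝ] E} (hS₀ : ∀ n, S (φ n) = S₀) :
    S₀ (gradient f x₀) = 0 := by
  have hd : Tendsto (fun n => ‖z (φ n) - x₀‖) atTop (𝓝 0) := by
    simpa using (hz.sub_const x₀).norm
  have hP : Tendsto (fun n => P (φ n)) atTop (𝓝 S₀) := by
    rw [tendsto_iff_norm_sub_tendsto_zero]
    refine squeeze_zero (fun _ => norm_nonneg _) (fun n => ?_) (by simpa using hd.const_mul C)
    rw [← hS₀ n]; exact hS _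
  have hG : Tendsto (fun n => gradient f (z (φ n))) atTop (𝓝 (gradient f x₀)) := by
    rw [tendsto_iff_norm_sub_tendsto_zero]
    exact squeeze_zero (fun _ => norm_nonneg _) (fun n => hf.2.2 _ _)
      (by simpa using hd.const_mul lam)
  exact tendsto_nhds_unique
    ((isBoundedBilinearMap_apply.continuous.tendsto (S₀, gradient f x₀)).comp (hP.prodMk_nhds hG))
    ((h.tendsto_proj_gradient hf hstep).comp hφ)

-- A trapping argument: a step shorter than `δ / 2` from the ball of radius `δ / 2` stays in the
-- ball of radius `δ`, where growth and the small value bring the point back within `δ / 2`.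
omit [FiniteDimensional ℝ E] in
theorem tendsto_of_growth (h : IsSubspaceMinimization f P z) {M : Set E} (hf : Continuous f)
    (hstep : Tendsto (fun j => z (j + 1) - z j) atTop (𝓝 0))
    (hφ : Tendsto φ atTop atTop) (hz : Tendsto (z ∘ φ) atTop (𝓝 x₀)) {c : ℝ} (hc : 0 < c)
    (hg : ∀ᶠ x in 𝓝[M] x₀, c * ‖x - x₀‖ ^ 2 ≤ f x - f x₀)
    (hM : ∀ᶠ x in 𝓝 x₀, x ∈ Set.range z → x ∈ M) : Tendsto z atTop (𝓝 x₀) := by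
  have hg' : ∀ᶠ x in 𝓝 x₀, x ∈ Set.range z → c * ‖x - x₀‖ ^ 2 ≤ f x - f x₀ := by
    filter_upwards [eventually_nhdsWithin_iff.1 hg, hM] with x h1 h2 h3 using h1 (h2 h3)
  obtain ⟨δ, hδ, hball⟩ := Metric.eventually_nhds_iff.1 hg'
  have hval := h.tendsto_value hf hφ hz
  have hval' : Tendsto (fun j => f (z j) - f x₀) atTop (𝓝 0) := by simpa using hval.sub_const (f x₀)
  have ev1 : ∀ᶠ j in atTop, f (z j) - f x₀ < c * (δ / 2) ^ 2 :=
    hval'.eventually_lt_const (by positivity)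
  have ev2 : ∀ᶠ j in atTop, ‖z (j + 1) - z j‖ < δ / 2 := by
    have := hstep.norm
    rw [norm_zero] at this
    exact this.eventually_lt_const (by positivity)
  have ev3 : ∀ᶠ n in atTop, ‖z (φ n) - x₀‖ < δ / 2 := by
    have := (hz.sub_const x₀).norm
    rw [sub_self, norm_zero] at this
    exact this.eventually_lt_const (by positivity)
  obtain ⟨N, hN⟩ := eventually_atTop.1 (ev1.and ev2)
  obtain ⟨n, hn1, hn2⟩ := (ev3.and (hφ.eventually_ge_atTop N)).exists
  have hin : ∀ j ≥ φ n, ‖z j - x₀‖ < δ / 2 := by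
    intro j hj
    induction j, hj using Nat.le_induction with
    | base => exact hn1
    | succ j hj ih =>
      have h1 := (hN j (hn2.trans hj)).2
      have h2 := (hN (j + 1) (by omega)).1
      have h3 : dist (z (j + 1)) x₀ < δ := by
        rw [dist_eq_norm]
        calc _ = ‖(z (j + 1) - z j) + (z j - x₀)‖ := by congr 1; abel
          _ ≤ _ := norm_add_le _ _
          _ < δ := by linarith
      have h4 := (hball h3 ⟨_, rfl⟩).trans_lt h2
      exact lt_of_pow_lt_pow_left₀ 2 (by positivity) (lt_of_mul_lt_mul_left h4 hc.le)
  rw [tendsto_iff_norm_sub_tendsto_zero]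
  have h5 : Tendsto (fun j => ‖z j - x₀‖ ^ 2) atTop (𝓝 0) := by
    have h6 : Tendsto (fun j => c⁻¹ * (f (z j) - f x₀)) atTop (𝓝 0) := by
      simpa using hval'.const_mul c⁻¹
    refine squeeze_zero' (Eventually.of_forall fun _ => by positivity) ?_ h6
    filter_upwards [eventually_ge_atTop (φ n)] with j hj
    have := hball (y := z j) (by rw [dist_eq_norm]; linarith [hin j hj]) ⟨_, rfl⟩
    rwa [le_inv_mul_iff₀ hc]
  simpa using h5.sqrt

/-- By `hT`, `ζ - P (j + 1) ζ` lies in the range of `P j`, orthogonal to the gradient, so only `P (j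
+ 1) ∇f` is seen by a tangent vector `ζ`; take `ζ` to be the Riemannian gradient. -/
theorem norm_riemannianGradient_le (h : IsSubspaceMinimization f P z) {M : Set E}
    (hf : Differentiable ℝ f) {j : ℕ}
    (hT : ∀ ζ ∈ tangentSpaceAt M (z (j + 1)), P j (ζ - P (j + 1) ζ) = ζ - P (j + 1) ζ) :
    ‖riemannianGradient M f (z (j + 1))‖ ≤ ‖P (j + 1) (gradient f (z (j + 1)))‖ := by
  set ζ := riemannianGradient M f (z (j + 1)) with hζ
  have hm : ζ ∈ tangentSpaceAt M (z (j + 1)) := Submodule.starProjection_apply_mem _ _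
  have h1 : ‖ζ‖ * ‖ζ‖ = inner ℝ (P (j + 1) (gradient f (z (j + 1)))) ζ := by
    rw [← real_inner_self_eq_norm_mul_norm]
    conv_lhs => rw [hζ, inner_riemannianGradient hm]
    have h2 : inner ℝ (gradient f (z (j + 1))) (ζ - P (j + 1) ζ) = 0 := by
      rw [← hT ζ hm, ← h.symm, h.proj_gradient_eq_zero hf, inner_zero_left]
    rw [inner_sub_right, sub_eq_zero] at h2
    rw [h2, h.symm]
  have h2 := h1 ▸ real_inner_le_norm (P (j + 1) (gradient f (z (j + 1)))) ζ
  rcases (norm_nonneg ζ).eq_or_lt with h3 | h3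
  · rw [← h3]; exact norm_nonneg _
  · exact le_of_mul_le_mul_right h2 h3

end IsSubspaceMinimization

/-! ### Descent per half-step and root-convergence rates. -/

/-- A gradient step in the range of `P` decreases a `C²` function by the amount that its second
derivative along that range allows. -/
theorem local_descent {f : E → ℝ} {x₀ : E} (hC2 : ContDiffAt ℝ 2 f x₀) {Λ ε : ℝ} (hΛ : 0 ≤ Λ)
    (hε : 0 < ε) :
    ∃ δ > 0, ∀ x ∈ Metric.ball x₀ δ, ∀ P S : E →L[ℝ] E, (∀ v, P (P v) = P v) →
      (∀ v w, inner ℝ (P v) w = inner ℝ v (P w)) → ‖P - S‖ < δ →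
      (∀ v, fderiv ℝ (fderiv ℝ f) x₀ (S v) (S v) ≤ Λ * ‖v‖ ^ 2) → ‖P (gradient f x)‖ < δ →
      f (x - (Λ + ε)⁻¹ • P (gradient f x)) ≤
        f x - (2 * (Λ + ε))⁻¹ * ‖P (gradient f x)‖ ^ 2 := by
  set B := fderiv ℝ (fderiv ℝ f) x₀ with hB
  obtain ⟨δ₀, hδ₀, ht⟩ := taylor_two_uniform hC2 (ε := ε / 4) (by positivity)
  have hL : 0 < Λ + ε := by positivity
  set τ := (Λ + ε)⁻¹ with hτ
  have hτ0 : 0 < τ := by positivity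
  -- The bounds with `δ₀` keep `x` and the new point in the Taylor ball; `1` gives `‖S η‖ ≤ 2 ‖η‖`;
  -- the bound with `‖B‖` limits the cost of replacing `P` by `S` to `ε / 2`. With the Taylor error
  -- the curvature is then at most `Λ + ε`.
  set δ := min (min (δ₀ / 2) 1) (min (ε / (6 * (‖B‖ + 1))) (δ₀ / 2 * (Λ + ε))) with hδ
  have hδpos : 0 < δ := by positivity
  have d1 : δ ≤ δ₀ / 2 := (min_le_left _ _).trans (min_le_left _ _)
  have d2 : δ ≤ 1 := (min_le_left _ _).trans (min_le_right _ _)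
  have d3 : δ ≤ ε / (6 * (‖B‖ + 1)) := (min_le_right _ _).trans (min_le_left _ _)
  have d4 : δ ≤ δ₀ / 2 * (Λ + ε) := (min_le_right _ _).trans (min_le_right _ _)
  refine ⟨δ, hδpos, fun x hx P S hi hs hPS hSB hG => ?_⟩
  set G := P (gradient f x) with hGdef
  set η := -(τ • G) with hη
  have hPη : P η = η := by simp [hη, hGdef, hi]
  have hnη : ‖η‖ = τ * ‖G‖ := by
    rw [hη, norm_neg, norm_smul, Real.norm_of_nonneg hτ0.le]
  have hxη : x - τ • G = x + η := by rw [hη]; abel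
  have hx1 : x ∈ Metric.ball x₀ δ₀ := Metric.ball_subset_ball (by linarith) hx
  have hηlt : ‖η‖ < δ₀ / 2 := by
    rw [hnη, hτ, inv_mul_lt_iff₀ hL]
    linarith
  have hy : x + η ∈ Metric.ball x₀ δ₀ := by
    rw [Metric.mem_ball, dist_eq_norm] at hx ⊢
    calc _ = ‖(x - x₀) + η‖ := by congr 1; abel
      _ ≤ _ := norm_add_le _ _
      _ < δ₀ := by linarith
  have h1 := (abs_le.1 (ht x hx1 _ hy)).2
  rw [add_sub_cancel_left] at h1
  have hlin : fderiv ℝ f x η = -(τ * ‖G‖ ^ 2) := by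
    rw [← inner_gradient_left, ← hPη, ← hs, ← hGdef, hη, inner_neg_right, real_inner_smul_right,
      real_inner_self_eq_norm_sq]
  have hPSη : ‖(P - S) η‖ ≤ δ * ‖η‖ := ((P - S).le_opNorm η).trans (by gcongr)
  have hη0 := norm_nonneg η
  have hSη : ‖S η‖ ≤ 2 * ‖η‖ := by
    have : S η = η - (P - S) η := by simp [hPη]
    rw [this]
    refine (norm_sub_le _ _).trans ?_
    nlinarith
  have hBηη : B η η ≤ (Λ + ε / 2) * ‖η‖ ^ 2 := by
    have e1 : B η η = B (S η) (S η) + B ((P - S) η) (S η) + B η ((P - S) η) := by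
      simp only [sub_apply, map_sub, hPη]
      ring
    have e2 : B ((P - S) η) (S η) ≤ ‖B‖ * (δ * ‖η‖) * (2 * ‖η‖) :=
      (Real.le_norm_self _).trans ((B.le_opNorm₂ _ _).trans (by gcongr))
    have e3 : B η ((P - S) η) ≤ ‖B‖ * ‖η‖ * (δ * ‖η‖) :=
      (Real.le_norm_self _).trans ((B.le_opNorm₂ _ _).trans (by gcongr))
    have e4 : ‖B‖ * δ ≤ ε / 6 := by
      calc ‖B‖ * δ ≤ ‖B‖ * (ε / (6 * (‖B‖ + 1))) := by gcongr
        _ ≤ ε / 6 := by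
          rw [mul_div_assoc', div_le_div_iff₀ (by positivity) (by positivity)]
          nlinarith [norm_nonneg B]
    have e5 := hSB η
    have e6 : ‖B‖ * δ * (3 * ‖η‖ ^ 2) ≤ ε / 6 * (3 * ‖η‖ ^ 2) := by gcongr
    rw [e1]
    linarith
  rw [hlin] at h1
  have h2 : τ * (Λ + ε) = 1 := inv_mul_cancel₀ hL.ne'
  have h3 : 2⁻¹ * (Λ + ε) * ‖η‖ ^ 2 = 2⁻¹ * τ * ‖G‖ ^ 2 := by
    rw [hnη]
    linear_combination (2⁻¹ * τ * ‖G‖ ^ 2) * h2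
  rw [hxη, mul_inv, ← hτ]
  linarith

omit [FiniteDimensional ℝ E] in
/-- Two `C²` functions that agree on a line near `x₀`, with equal first derivatives along it,
have the same second derivative along it. -/
theorem fderiv_fderiv_eq_of_eq_on_line {f g : E → ℝ} {x₀ ξ : E} (hf : ContDiffAt ℝ 2 f x₀)
    (hg : ContDiffAt ℝ 2 g x₀) (h1 : fderiv ℝ f x₀ ξ = fderiv ℝ g x₀ ξ)
    (hfg : ∀ᶠ t : ℝ in 𝓝 0, f (x₀ + t • ξ) = g (x₀ + t • ξ)) :
    fderiv ℝ (fderiv ℝ f) x₀ ξ ξ = fderiv ℝ (fderiv ℝ g) x₀ ξ ξ := by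
  rw [← sub_eq_zero, ← abs_eq_zero]
  refine le_antisymm (le_of_forall_pos_le_add fun ε hε => ?_) (abs_nonneg _)
  have hε' : 0 < ε / (4 * (‖ξ‖ ^ 2 + 1)) := by positivity
  obtain ⟨δ₁, hδ₁, hf'⟩ := taylor_two_uniform hf hε'
  obtain ⟨δ₂, hδ₂, hg'⟩ := taylor_two_uniform hg hε'
  have hcont : Tendsto (fun t : ℝ => x₀ + t • ξ) (𝓝 0) (𝓝 x₀) := by
    have : Continuous (fun t : ℝ => x₀ + t • ξ) := by fun_prop
    simpa using this.tendsto 0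
  have hev := (hfg.and ((hcont.eventually (Metric.ball_mem_nhds x₀ hδ₁)).and
    (hcont.eventually (Metric.ball_mem_nhds x₀ hδ₂))))
  obtain ⟨t, ⟨e1, e2, e3⟩, ht⟩ := ((hev.filter_mono nhdsWithin_le_nhds).and
    (self_mem_nhdsWithin (s := Set.Ioi (0 : ℝ)))).exists
  have ht : 0 < t := ht
  have i1 := hf' x₀ (Metric.mem_ball_self hδ₁) _ e2
  have i2 := hg' x₀ (Metric.mem_ball_self hδ₂) _ e3
  have hz := hfg.self_of_nhds
  simp only [zero_smul, add_zero] at hz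
  simp only [add_sub_cancel_left, map_smul, smul_apply, smul_eq_mul,
    norm_smul, Real.norm_of_nonneg ht.le] at i1 i2
  rw [e1, hz, h1] at i1
  set a := fderiv ℝ (fderiv ℝ f) x₀ ξ ξ
  set b := fderiv ℝ (fderiv ℝ g) x₀ ξ ξ
  have i3 : ε / (4 * (‖ξ‖ ^ 2 + 1)) * (t * ‖ξ‖) ^ 2 ≤ ε / 4 * t ^ 2 := by
    rw [div_mul_eq_mul_div, div_le_iff₀ (by positivity)]
    nlinarith [mul_pos hε (pow_pos ht 2), sq_nonneg ‖ξ‖]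
  have i4 : t ^ 2 * |a - b| ≤ t ^ 2 * ε := by
    rw [← abs_of_pos (pow_pos ht 2), ← abs_mul, abs_of_pos (pow_pos ht 2), abs_le]
    have j1 := abs_le.1 (i1.trans i3)
    have j2 := abs_le.1 (i2.trans i3)
    constructor <;> nlinarith [j1.1, j1.2, j2.1, j2.2]
  rw [zero_add]
  exact le_of_mul_le_mul_left i4 (by positivity)

/-- The constant is harmless since `C ^ (1 / n)` tends to `1`. In `EReal` the `limsup` needs no
boundedness side condition. -/
theorem limsup_root_le {a : ℕ → ℝ} (ha : ∀ n, 0 ≤ a n) {b₀ : ℝ} (hb₀ : 0 ≤ b₀)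
    (h : ∀ b > b₀, ∃ C > 0, ∀ᶠ n in atTop, a n ≤ C * b ^ n) :
    limsup (fun n : ℕ => ((a n ^ (1 / (n : ℝ)) : ℝ) : EReal)) atTop ≤ (b₀ : EReal) := by
  refine EReal.le_of_forall_lt_iff_le.1 fun b hb => ?_
  have hb : b₀ < b := by exact_mod_cast hb
  have hbpos : 0 < b := hb₀.trans_lt hb
  obtain ⟨C, hC, hle⟩ := h b hb
  have hlim : Tendsto (fun n : ℕ => ((C ^ (1 / (n : ℝ)) * b : ℝ) : EReal)) atTop (𝓝 (b : EReal)) := by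
    refine (continuous_coe_real_ereal.tendsto _).comp ?_
    have h1 : Tendsto (fun n : ℕ => C ^ (1 / (n : ℝ))) atTop (𝓝 (C ^ (0 : ℝ))) :=
      (Real.continuousAt_const_rpow hC.ne').tendsto.comp tendsto_one_div_atTop_nhds_zero_nat
    simpa using h1.mul_const b
  rw [← hlim.limsup_eq]
  refine limsup_le_limsup ?_
  filter_upwards [hle, eventually_gt_atTop 0] with n h1 h2
  have hn : (n : ℝ) ≠ 0 := by positivity
  rw [EReal.coe_le_coe_iff]
  calc a n ^ (1 / (n : ℝ)) ≤ (C * b ^ n) ^ (1 / (n : ℝ)) := by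
        gcongr
        exact ha n
    _ = C ^ (1 / (n : ℝ)) * b := by
        rw [Real.mul_rpow hC.le (by positivity), ← Real.rpow_natCast b n, ← Real.rpow_mul hbpos.le,
          mul_one_div_cancel hn, Real.rpow_one]

theorem exists_le_geometric {e : ℕ → ℝ} {θ : ℝ} (hθ : 0 < θ)
    (h : ∀ᶠ n in atTop, e (n + 1) ≤ θ * e n) : ∃ C > 0, ∀ᶠ n in atTop, e n ≤ C * θ ^ n := by
  obtain ⟨N, hN⟩ := eventually_atTop.1 h
  refine ⟨(|e N| + 1) / θ ^ N, by positivity, eventually_atTop.2 ⟨N, fun n hn => ?_⟩⟩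
  induction n, hn using Nat.le_induction with
  | base =>
    rw [div_mul_cancel₀ _ (by positivity)]
    linarith [le_abs_self (e N)]
  | succ n hn ih =>
    calc _ ≤ θ * e n := hN n hn
      _ ≤ θ * ((|e N| + 1) / θ ^ N * θ ^ n) := by gcongr
      _ = _ := by ring

variable {f : E → ℝ} {P S : ℕ → E →L[ℝ] E} {z : ℕ → E} {x₀ : E} {M : Set E} {ρ : E → E} {l Λ : ℝ}

namespace IsSubspaceMinimization

theorem eventually_contraction (h : IsSubspaceMinimization f P z) (hf : Differentiable ℝ f)
    (hC2 : ContDiffAt ℝ 2 f x₀) (hρ : IsLocalRetraction M ρ x₀) (hx : x₀ ∈ M)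
    (h0 : riemannianGradient M f x₀ = 0)
    (hD : DifferentiableWithinAt ℝ (riemannianGradient M f) M x₀)
    (hH : ∀ ξ, l * ‖ξ‖ ^ 2 ≤ inner ℝ (riemannianHessian M f x₀ ξ) ξ) (hl : 0 < l) (hΛ : 0 < Λ)
    (hz : Tendsto z atTop (𝓝 x₀)) (hle : ∀ j, f x₀ ≤ f (z j)) {C : ℝ}
    (hS : ∀ j, ‖P j - S j‖ ≤ C * ‖z j - x₀‖)
    (hSB : ∀ j v, fderiv ℝ (fderiv ℝ f) x₀ (S j v) (S j v) ≤ Λ * ‖v‖ ^ 2)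
    (hG : Tendsto (fun j => P j (gradient f (z j))) atTop (𝓝 0))
    (hM : ∀ᶠ j in atTop, z j ∈ M)
    (hT : ∀ᶠ j in atTop, ∀ ζ ∈ tangentSpaceAt M (z (j + 1)),
      P j (ζ - P (j + 1) ζ) = ζ - P (j + 1) ζ)
    {θ : ℝ} (hθ : 1 - l / Λ < θ) :
    ∀ᶠ j in atTop, f (z (j + 1)) - f x₀ ≤ θ * (f (z j) - f x₀) := by
  -- The slack `s` is spent twice: gradient domination with `κ = l - s` and descent with `Λ + s`.
  have hs : ∀ᶠ s in 𝓝[>] (0 : ℝ), 1 - (l - s) / (Λ + s) < θ := by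
    have : Tendsto (fun s : ℝ => 1 - (l - s) / (Λ + s)) (𝓝 0) (𝓝 (1 - (l - 0) / (Λ + 0))) := by
      refine ContinuousAt.tendsto (f := fun s : ℝ => 1 - (l - s) / (Λ + s)) ?_
      have : Λ + 0 ≠ 0 := by simpa using hΛ.ne'
      fun_prop (disch := assumption)
    rw [sub_zero, add_zero] at this
    exact (this.eventually_lt_const hθ).filter_mono nhdsWithin_le_nhds
  obtain ⟨s, hs1, hs2⟩ := (hs.and (Ioo_mem_nhdsGT hl)).exists
  obtain ⟨δ, hδ, hdesc⟩ := local_descent hC2 (ε := s) hΛ.le hs2.1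
  have hzM : Tendsto z atTop (𝓝[M] x₀) := tendsto_nhdsWithin_iff.2 ⟨hz, hM⟩
  have hPL := hzM.eventually (local_gradient_domination hρ hx hf hC2 h0 hD hH (κ := l - s)
    (by linarith [hs2.2]) (by linarith [hs2.1]))
  have ev1 : ∀ᶠ j in atTop, ‖P j - S j‖ < δ := by
    have hd : Tendsto (fun j => C * ‖z j - x₀‖) atTop (𝓝 0) := by
      simpa using ((hz.sub_const x₀).norm).const_mul C
    filter_upwards [hd.eventually_lt_const hδ] with j hj using (hS j).trans_lt hj
  have ev2 : ∀ᶠ j in atTop, ‖P j (gradient f (z j))‖ < δ := by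
    have := hG.norm
    rw [norm_zero] at this
    exact this.eventually_lt_const hδ
  have hT' : ∀ᶠ j in atTop, ‖riemannianGradient M f (z j)‖ ≤ ‖P j (gradient f (z j))‖ := by
    obtain ⟨N, hN⟩ := eventually_atTop.1 hT
    refine eventually_atTop.2 ⟨N + 1, fun j hj => ?_⟩
    obtain ⟨i, rfl⟩ : ∃ i, j = i + 1 := ⟨j - 1, by omega⟩
    exact h.norm_riemannianGradient_le hf (hN i (by omega))
  filter_upwards [hPL, ev1, ev2, hT', hz.eventually (Metric.ball_mem_nhds x₀ hδ)]
    with j h1 h2 h3 h4 h5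
  have h6 := hdesc (z j) h5 (P j) (S j) (h.idem j) (h.symm j) h2 (hSB j) h3
  -- The gradient step stays in the range of `P j`, so it is a competitor in the exact minimization.
  have h7 := h.min j (z j - (Λ + s)⁻¹ • P j (gradient f (z j)))
    (by rw [map_sub, h.left, map_smul, h.idem])
  have hpos : 0 < Λ + s := by linarith [hs2.1]
  have h8 : 2 * (l - s) * (f (z j) - f x₀) ≤ ‖P j (gradient f (z j))‖ ^ 2 :=
    h1.trans (by gcongr)
  have h9 : (2 * (Λ + s))⁻¹ * (2 * (l - s) * (f (z j) - f x₀)) ≤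
      (2 * (Λ + s))⁻¹ * ‖P j (gradient f (z j))‖ ^ 2 := by gcongr
  have h10 : (2 * (Λ + s))⁻¹ * (2 * (l - s) * (f (z j) - f x₀)) =
      (l - s) / (Λ + s) * (f (z j) - f x₀) := by field_simp
  have h11 : (1 - (l - s) / (Λ + s)) * (f (z j) - f x₀) ≤ θ * (f (z j) - f x₀) := by
    have := sub_nonneg.2 (hle j)
    gcongr
  linarith

end IsSubspaceMinimization

-- Index `2 * n` means two contractions per `n`, hence `θ ^ 2` for values; growth gives `θ` for
-- distances.
omit [InnerProductSpace ℝ E] [FiniteDimensional ℝ E] in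
theorem limsup_le_of_contraction (hl : l ≤ Λ) (hΛ : 0 < Λ)
    (hle : ∀ j, f x₀ ≤ f (z j)) {c : ℝ} (hc : 0 < c)
    (hg : ∀ᶠ j in atTop, c * ‖z j - x₀‖ ^ 2 ≤ f (z j) - f x₀)
    (hcontr : ∀ θ : ℝ, 1 - l / Λ < θ →
      ∀ᶠ j in atTop, f (z (j + 1)) - f x₀ ≤ θ * (f (z j) - f x₀)) :
    limsup (fun n : ℕ => ((‖z (2 * n) - x₀‖ ^ (1 / (n : ℝ)) : ℝ) : EReal)) atTop ≤
        ((1 - l / Λ : ℝ) : EReal) ∧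
      limsup (fun n : ℕ => (((f (z (2 * n)) - f x₀) ^ (1 / (n : ℝ)) : ℝ) : EReal)) atTop ≤
        (((1 - l / Λ) ^ 2 : ℝ) : EReal) := by
  have hθ₀ : 0 ≤ 1 - l / Λ := sub_nonneg.2 ((div_le_one hΛ).2 hl)
  have h2 : Tendsto (fun n : ℕ => 2 * n) atTop atTop :=
    tendsto_id.const_mul_atTop' (by norm_num)
  have key : ∀ θ > 1 - l / Λ, ∃ C > 0, ∀ᶠ n : ℕ in atTop, f (z (2 * n)) - f x₀ ≤ C * (θ ^ 2) ^ n := by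
    intro θ hθ
    obtain ⟨C, hC, hle⟩ := exists_le_geometric (e := fun j => f (z j) - f x₀)
      (hθ₀.trans_lt hθ) (hcontr θ hθ)
    refine ⟨C, hC, ?_⟩
    filter_upwards [h2.eventually hle] with n hn
    rwa [← pow_mul]
  refine ⟨limsup_root_le (fun _ => norm_nonneg _) hθ₀ fun b hb => ?_,
    limsup_root_le (fun _ => sub_nonneg.2 (hle _)) (by positivity) fun b hb => ?_⟩
  · have hbpos : 0 < b := hθ₀.trans_lt hb
    obtain ⟨C, hC, hev⟩ := key b hb
    refine ⟨√(C / c), by positivity, ?_⟩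
    filter_upwards [hev, h2.eventually hg] with n h3 h4
    refine le_of_sq_le_sq ?_ (by positivity)
    rw [mul_pow, Real.sq_sqrt (by positivity), div_mul_eq_mul_div, le_div_iff₀ hc, ← pow_mul,
      mul_comm n 2, pow_mul]
    linarith
  · have hbpos : 0 < b := (sq_nonneg _).trans_lt hb
    obtain ⟨C, hC, hev⟩ := key (√b) (Real.lt_sqrt_of_sq_lt hb)
    rw [Real.sq_sqrt hbpos.le] at hev
    exact ⟨C, hC, hev⟩

/-- The smallest eigenvalue of the Riemannian Hessian is at most any bound on the second derivative
of `f` along a line that stays in `M` near a critical point. -/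
theorem le_of_line_mem (hf : Differentiable ℝ f)
    (hC2 : ContDiffAt ℝ 2 f x₀) (hρ : IsLocalRetraction M ρ x₀) (hx : x₀ ∈ M)
    (h0 : riemannianGradient M f x₀ = 0)
    (hD : DifferentiableWithinAt ℝ (riemannianGradient M f) M x₀)
    (hH : ∀ ξ, l * ‖ξ‖ ^ 2 ≤ inner ℝ (riemannianHessian M f x₀ ξ) ξ) {ξ : E} (hξ0 : ξ ≠ 0)
    (hξ : ξ ∈ tangentSpaceAt M x₀)
    (hline : ∀ᶠ t : ℝ in 𝓝 0, x₀ + t • ξ ∈ M)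
    (hB : fderiv ℝ (fderiv ℝ f) x₀ ξ ξ ≤ Λ * ‖ξ‖ ^ 2) : l ≤ Λ := by
  have hx' := hρ.eq_self.self_of_nhds hx
  have hg : ContDiffAt ℝ 2 (f ∘ ρ) x₀ := ContDiffAt.comp x₀ (by rwa [hx']) hρ.contDiffAt
  have hcont : Tendsto (fun t : ℝ => x₀ + t • ξ) (𝓝 0) (𝓝 x₀) := by
    have : Continuous (fun t : ℝ => x₀ + t • ξ) := by fun_prop
    simpa using this.tendsto 0
  have h1 : fderiv ℝ f x₀ ξ = fderiv ℝ (f ∘ ρ) x₀ ξ := by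
    rw [fderiv_comp_retraction hf hρ hx, hρ.fderiv_eq_self hx hξ, inner_riemannianGradient hξ,
      inner_gradient_left]
  -- `ρ` is the identity on the line, so there the Riemannian Hessian form equals the Euclidean one.
  have h2 := fderiv_fderiv_eq_of_eq_on_line hC2 hg h1 (by
    filter_upwards [hline, hcont.eventually hρ.eq_self] with t h3 h4
    simp [h4 h3])
  have h3 := hH ⟨ξ, hξ⟩
  rw [← fderiv_fderiv_comp_retraction hρ hx hf hC2 h0 hD] at h3
  have hpos : 0 < ‖ξ‖ := norm_pos_iff.2 hξ0
  refine le_of_mul_le_mul_right (h3.trans ?_) (pow_pos hpos 2)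
  rw [← h2]
  exact hB

end Abstract

/-! ### The Euclidean Hessian as a bilinear form. -/

section Gradient
variable {E : Type*} [NormedAddCommGroup E] [InnerProductSpace ℝ E] [FiniteDimensional ℝ E]

theorem inner_euclideanHessian {f : E → ℝ} {x : E} (hf : ContDiffAt ℝ 2 f x) (v w : E) :
    inner ℝ (euclideanHessian f x v) w = fderiv ℝ (fderiv ℝ f) x v w := by
  have d1 : HasFDerivAt (fderiv ℝ f) (fderiv ℝ (fderiv ℝ f) x) x :=
    ((hf.fderiv_right (m := 1) (by norm_num)).differentiableAt (by norm_num)).hasFDerivAt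
  have d2 : DifferentiableAt ℝ (gradient f) x := by
    set b := stdOrthonormalBasis ℝ E
    have : gradient f = fun y => ∑ i, fderiv ℝ f y (b i) • b i := by
      ext y
      conv_lhs => rw [← b.sum_repr (gradient f y)]
      refine Finset.sum_congr rfl fun i _ => ?_
      rw [b.repr_apply_apply, real_inner_comm, inner_gradient_left]
    rw [this]
    have := d1.differentiableAt
    fun_prop
  have d3 := d2.hasFDerivAt.inner ℝ (hasFDerivAt_const w x)
  have d4 : (fun y => inner ℝ (gradient f y) w) = fun y => fderiv ℝ f y w := by
    ext y; exact inner_gradient_left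
  rw [d4] at d3
  have d5 := DFunLike.congr_fun (d3.unique (d1.clm_apply (hasFDerivAt_const w x))) v
  simpa [fderivInnerCLM_apply, euclideanHessian] using d5

theorem fderiv_fderiv_le_opNorm {f : E → ℝ} {x : E} (hf : ContDiffAt ℝ 2 f x) {S : E →L[ℝ] E}
    (hs : ∀ v w, inner ℝ (S v) w = inner ℝ v (S w)) (v : E) :
    fderiv ℝ (fderiv ℝ f) x (S v) (S v) ≤ ‖S ∘L euclideanHessian f x ∘L S‖ * ‖v‖ ^ 2 := by
  rw [← inner_euclideanHessian hf, ← hs]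
  calc _ ≤ ‖(S ∘L euclideanHessian f x ∘L S) v‖ * ‖v‖ := real_inner_le_norm _ _
    _ ≤ ‖S ∘L euclideanHessian f x ∘L S‖ * ‖v‖ * ‖v‖ := by
      gcongr
      exact ContinuousLinearMap.le_opNorm _ _
    _ = _ := by ring
end Gradient

/-! ### Row and column space projections and their perturbation. -/

section MatrixFacts
open Matrix
variable {m n k p : ℕ}

theorem inner_eq_trace (A B : Matrix (Fin m) (Fin n) ℝ) : inner ℝ A B = (Aᵀ * B).trace := rfl

theorem norm_sq_eq_trace (A : Matrix (Fin m) (Fin n) ℝ) : ‖A‖ ^ 2 = (Aᵀ * A).trace := by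
  rw [← inner_eq_trace, real_inner_self_eq_norm_sq]

theorem projV_apply (V : Matrix (Fin n) (Fin k) ℝ) (Z : Matrix (Fin m) (Fin n) ℝ) :
    projV m V Z = Z * (V * Vᵀ) := rfl

theorem projU_apply (U : Matrix (Fin m) (Fin k) ℝ) (Z : Matrix (Fin m) (Fin n) ℝ) :
    projU n U Z = U * Uᵀ * Z := rfl

theorem mul_transpose_idem {V : Matrix (Fin n) (Fin k) ℝ} (hV : Vᵀ * V = 1) :
    V * Vᵀ * (V * Vᵀ) = V * Vᵀ := by
  rw [Matrix.mul_assoc, ← Matrix.mul_assoc Vᵀ, hV, Matrix.one_mul]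

theorem projV_idem {V : Matrix (Fin n) (Fin k) ℝ} (hV : Vᵀ * V = 1)
    (Z : Matrix (Fin m) (Fin n) ℝ) : projV m V (projV m V Z) = projV m V Z := by
  rw [projV_apply, projV_apply, Matrix.mul_assoc, mul_transpose_idem hV]

theorem projU_idem {U : Matrix (Fin m) (Fin k) ℝ} (hU : Uᵀ * U = 1)
    (Z : Matrix (Fin m) (Fin n) ℝ) : projU n U (projU n U Z) = projU n U Z := by
  rw [projU_apply, projU_apply, ← Matrix.mul_assoc, mul_transpose_idem hU]

theorem projV_symm (V : Matrix (Fin n) (Fin k) ℝ) (Z W : Matrix (Fin m) (Fin n) ℝ) :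
    inner ℝ (projV m V Z) W = inner ℝ Z (projV m V W) := by
  rw [inner_eq_trace, inner_eq_trace, projV_apply, projV_apply, transpose_mul, transpose_mul,
    transpose_transpose, Matrix.mul_assoc, trace_mul_comm, Matrix.mul_assoc Zᵀ]

theorem projU_symm (U : Matrix (Fin m) (Fin k) ℝ) (Z W : Matrix (Fin m) (Fin n) ℝ) :
    inner ℝ (projU n U Z) W = inner ℝ Z (projU n U W) := by
  rw [inner_eq_trace, inner_eq_trace, projU_apply, projU_apply, transpose_mul, transpose_mul,
    transpose_transpose, Matrix.mul_assoc]

/-- Nearness of symmetric idempotents of equal trace. -/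
theorem norm_sub_idem_le {P Q : Matrix (Fin n) (Fin n) ℝ} (hP : P * P = P) (hQ : Q * Q = Q)
    (hPt : Pᵀ = P) (hQt : Qᵀ = Q) (htr : P.trace = Q.trace) {X Y : Matrix (Fin m) (Fin n) ℝ}
    {G : Matrix (Fin n) (Fin m) ℝ} (hG : G * Y = Q) (hX : X * P = X) :
    ‖P - Q‖ ≤ 2 * ‖G‖ * (1 + ‖Q‖) * ‖X - Y‖ := by
  have hnorm : ‖P‖ = ‖Q‖ := by
    have h1 : ‖P‖ ^ 2 = ‖Q‖ ^ 2 := by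
      rw [norm_sq_eq_trace, norm_sq_eq_trace, hPt, hQt, hP, hQ, htr]
    exact (sq_eq_sq₀ (norm_nonneg _) (norm_nonneg _)).1 h1
  -- Equal traces give `‖P - Q‖² = 2 ‖Q - Q P‖²`. Since `X P = X`, the matrix `Q - Q P` depends only
  -- on `Y - X`, which gives a bound linear in the distance.
  have h1 : ‖P - Q‖ ^ 2 = 2 * (Q.trace - (P * Q).trace) := by
    rw [norm_sq_eq_trace, transpose_sub, hPt, hQt, Matrix.sub_mul, Matrix.mul_sub, Matrix.mul_sub,
      hP, hQ, trace_sub, trace_sub, trace_sub, htr, trace_mul_comm Q P]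
    ring
  have h2 : ‖Q - Q * P‖ ^ 2 = Q.trace - (P * Q).trace := by
    rw [norm_sq_eq_trace, transpose_sub, transpose_mul, hPt, hQt, Matrix.sub_mul, Matrix.mul_sub,
      Matrix.mul_sub, hQ, ← Matrix.mul_assoc Q Q P, hQ, Matrix.mul_assoc P Q Q, hQ, trace_sub,
      trace_sub, trace_sub, Matrix.mul_assoc P Q, ← Matrix.mul_assoc Q Q P, hQ,
      trace_mul_comm P (Q * P), Matrix.mul_assoc, hP, trace_mul_comm Q P]
    ring
  have h3 : Q - Q * P = G * ((Y - X) - (Y - X) * P) := by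
    rw [← hG, Matrix.sub_mul, hX, Matrix.mul_sub, Matrix.mul_sub, Matrix.mul_sub,
      Matrix.mul_assoc]
    abel
  have h4 : ‖Q - Q * P‖ ≤ ‖G‖ * ((1 + ‖Q‖) * ‖X - Y‖) := by
    rw [h3]
    refine (frobenius_norm_mul _ _).trans ?_
    gcongr
    refine (norm_sub_le _ _).trans ?_
    have := frobenius_norm_mul (Y - X) P
    rw [hnorm] at this
    rw [norm_sub_rev X Y]
    linarith
  refine le_of_sq_le_sq ?_ (by positivity)
  calc ‖P - Q‖ ^ 2 = 2 * ‖Q - Q * P‖ ^ 2 := by rw [h1, h2]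
    _ ≤ 2 * (‖G‖ * ((1 + ‖Q‖) * ‖X - Y‖)) ^ 2 := by gcongr
    _ ≤ (2 * ‖G‖ * (1 + ‖Q‖) * ‖X - Y‖) ^ 2 := by
      nlinarith [sq_nonneg (‖G‖ * ((1 + ‖Q‖) * ‖X - Y‖))]

theorem trace_mul_transpose {V : Matrix (Fin n) (Fin k) ℝ} (hV : Vᵀ * V = 1) :
    (V * Vᵀ).trace = k := by
  rw [trace_mul_comm, hV, trace_one, Fintype.card_fin]

theorem norm_projV_sub_le (V W : Matrix (Fin n) (Fin k) ℝ) :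
    ‖projV m V - projV m W‖ ≤ ‖V * Vᵀ - W * Wᵀ‖ := by
  refine ContinuousLinearMap.opNorm_le_bound _ (norm_nonneg _) fun Z => ?_
  rw [_root_.sub_apply, projV_apply, projV_apply, ← Matrix.mul_sub, mul_comm]
  exact frobenius_norm_mul _ _

theorem norm_projU_sub_le (V W : Matrix (Fin m) (Fin k) ℝ) :
    ‖projU n V - projU n W‖ ≤ ‖V * Vᵀ - W * Wᵀ‖ := by
  refine ContinuousLinearMap.opNorm_le_bound _ (norm_nonneg _) fun Z => ?_
  rw [_root_.sub_apply, projU_apply, projU_apply, ← Matrix.sub_mul]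
  exact frobenius_norm_mul _ _

theorem exists_norm_projV_sub_le {Us : Matrix (Fin m) (Fin k) ℝ} {Ss : Matrix (Fin k) (Fin k) ℝ}
    {Vs : Matrix (Fin n) (Fin k) ℝ} (hU : Usᵀ * Us = 1) (hV : Vsᵀ * Vs = 1) (hS : IsUnit Ss.det) :
    ∃ C : ℝ, ∀ (X : Matrix (Fin m) (Fin n) ℝ) (Q : Matrix (Fin n) (Fin k) ℝ), Qᵀ * Q = 1 →
      projV m Q X = X → ‖projV m Q - projV m Vs‖ ≤ C * ‖X - Us * Ss * Vsᵀ‖ := by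
  refine ⟨2 * ‖Vs * Ss⁻¹ * Usᵀ‖ * (1 + ‖Vs * Vsᵀ‖), fun X Q hQ hX =>
    (norm_projV_sub_le Q Vs).trans (norm_sub_idem_le (mul_transpose_idem hQ)
      (mul_transpose_idem hV) (by simp) (by simp)
      (by rw [trace_mul_transpose hQ, trace_mul_transpose hV]) ?_ hX)⟩
  calc Vs * Ss⁻¹ * Usᵀ * (Us * Ss * Vsᵀ) = Vs * (Ss⁻¹ * ((Usᵀ * Us) * Ss)) * Vsᵀ := by
        simp only [Matrix.mul_assoc]
    _ = Vs * Vsᵀ := by rw [hU, Matrix.one_mul, nonsing_inv_mul _ hS, Matrix.mul_one]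

theorem exists_norm_projU_sub_le {Us : Matrix (Fin m) (Fin k) ℝ} {Ss : Matrix (Fin k) (Fin k) ℝ}
    {Vs : Matrix (Fin n) (Fin k) ℝ} (hU : Usᵀ * Us = 1) (hV : Vsᵀ * Vs = 1) (hS : IsUnit Ss.det) :
    ∃ C : ℝ, ∀ (X : Matrix (Fin m) (Fin n) ℝ) (Q : Matrix (Fin m) (Fin k) ℝ), Qᵀ * Q = 1 →
      projU n Q X = X → ‖projU n Q - projU n Us‖ ≤ C * ‖X - Us * Ss * Vsᵀ‖ := by
  refine ⟨2 * ‖Us * Ssᵀ⁻¹ * Vsᵀ‖ * (1 + ‖Us * Usᵀ‖), fun X Q hQ hX => ?_⟩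
  rw [← frobenius_norm_transpose (X - _), transpose_sub]
  refine (norm_projU_sub_le Q Us).trans (norm_sub_idem_le (mul_transpose_idem hQ)
      (mul_transpose_idem hU) (by simp) (by simp)
      (by rw [trace_mul_transpose hQ, trace_mul_transpose hU]) ?_ ?_)
  · calc Us * Ssᵀ⁻¹ * Vsᵀ * (Us * Ss * Vsᵀ)ᵀ = Us * (Ssᵀ⁻¹ * ((Vsᵀ * Vs) * Ssᵀ)) * Usᵀ := by
          simp only [Matrix.mul_assoc, transpose_mul, transpose_transpose]
      _ = Us * Usᵀ := by
          rw [hV, Matrix.one_mul, nonsing_inv_mul _ (by rwa [det_transpose]), Matrix.mul_one]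
  · have := congrArg transpose hX
    rwa [projU_apply, transpose_mul, transpose_mul, transpose_transpose] at this

/-! ### Fixed-rank matrices: cross retraction and tangent space. -/

theorem le_rank_of_isUnit_det {X : Matrix (Fin m) (Fin n) ℝ} {U : Matrix (Fin m) (Fin k) ℝ}
    {V : Matrix (Fin n) (Fin k) ℝ} (h : IsUnit (Uᵀ * X * V).det) : k ≤ X.rank := by
  have h1 : (Uᵀ * X * V).rank = k := by
    rw [rank_of_isUnit _ ((isUnit_iff_isUnit_det _).2 h), Fintype.card_fin]
  calc k = (Uᵀ * X * V).rank := h1.symm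
    _ ≤ (Uᵀ * X).rank := rank_mul_le_left _ _
    _ ≤ X.rank := rank_mul_le_right _ _

theorem isUnit_det_of_rank {X : Matrix (Fin m) (Fin n) ℝ} {U : Matrix (Fin m) (Fin k) ℝ}
    {S : Matrix (Fin k) (Fin k) ℝ} {V : Matrix (Fin n) (Fin k) ℝ} (hX : X = U * S * Vᵀ)
    (hr : X.rank = k) : IsUnit S.det := by
  have h1 : k ≤ S.rank := by
    calc k = (U * S * Vᵀ).rank := by rw [← hX, hr]
      _ ≤ S.rank := (rank_mul_le_left _ _).trans (rank_mul_le_right _ _)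
  have h2 : LinearMap.range S.mulVecLin = ⊤ := by
    refine Submodule.eq_top_of_finrank_eq (le_antisymm (Submodule.finrank_le _) ?_)
    rw [Module.finrank_pi, Fintype.card_fin]
    exact h1
  rw [← isUnit_iff_isUnit_det, ← mulVec_surjective_iff_isUnit]
  exact LinearMap.range_eq_top.1 h2

/-- A matrix of rank `k` is recovered from `k` row and `k` column combinations whose
intersection is invertible. -/
theorem eq_cross_of_rank {X : Matrix (Fin m) (Fin n) ℝ} {U : Matrix (Fin m) (Fin k) ℝ}
    {V : Matrix (Fin n) (Fin k) ℝ} (h : IsUnit (Uᵀ * X * V).det) (hr : X.rank = k) :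
    X * V * (Uᵀ * X * V)⁻¹ * (Uᵀ * X) = X := by
  -- Equal rank makes the column spaces of `X * V` and `X` equal, so `X = X * V * C`; multiplying by
  -- `Uᵀ` identifies `C`.
  have hXV : (X * V).rank = X.rank := by
    refine le_antisymm (rank_mul_le_left _ _) ?_
    rw [hr]
    have := le_rank_of_isUnit_det (X := X * V) (U := U) (V := 1) (by
      simpa [Matrix.mul_assoc] using h)
    exact this
  have hrange : LinearMap.range (X * V).mulVecLin = LinearMap.range X.mulVecLin := by
    refine Submodule.eq_of_le_of_finrank_eq ?_ hXV
    rw [mulVecLin_mul]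
    exact LinearMap.range_comp_le_range _ _
  have hcol : ∀ j, ∃ c : Fin k → ℝ, (X * V) *ᵥ c = X.col j := by
    intro j
    have : X.col j ∈ LinearMap.range (X * V).mulVecLin := by
      rw [hrange]
      exact ⟨Pi.single j 1, by simp⟩
    exact this
  choose c hc using hcol
  have hXC : X = X * V * (Matrix.of fun i j => c j i) := by
    ext i j
    exact (congrFun (hc j) i).symm
  set C : Matrix (Fin k) (Fin n) ℝ := Matrix.of fun i j => c j i
  have hC : (Uᵀ * X * V)⁻¹ * (Uᵀ * X) = C := by
    have : Uᵀ * X = Uᵀ * X * V * C := by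
      conv_lhs => rw [hXC]
      simp only [Matrix.mul_assoc]
    calc (Uᵀ * X * V)⁻¹ * (Uᵀ * X) = (Uᵀ * X * V)⁻¹ * (Uᵀ * X * V * C) := congrArg _ this
      _ = C := by rw [← Matrix.mul_assoc, nonsing_inv_mul _ h, Matrix.one_mul]
  rw [Matrix.mul_assoc, hC, ← hXC]

/-- Multiplication of rectangular matrices as a continuous bilinear map. -/
noncomputable def mulCLM : Matrix (Fin m) (Fin n) ℝ →L[ℝ] Matrix (Fin n) (Fin p) ℝ →L[ℝ]
    Matrix (Fin m) (Fin p) ℝ :=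
  LinearMap.mkContinuous₂ (LinearMap.mk₂ ℝ (fun A B => A * B) Matrix.add_mul
    (fun c A B => Matrix.smul_mul c A B) Matrix.mul_add (fun c A B => Matrix.mul_smul A c B)) 1
    (fun A B => by rw [one_mul]; exact frobenius_norm_mul A B)

theorem contDiffAt_mul {E : Type*} [NormedAddCommGroup E] [NormedSpace ℝ E] {r : WithTop ℕ∞}
    {a : E → Matrix (Fin m) (Fin n) ℝ} {b : E → Matrix (Fin n) (Fin p) ℝ} {x : E}
    (ha : ContDiffAt ℝ r a x) (hb : ContDiffAt ℝ r b x) : ContDiffAt ℝ r (fun y => a y * b y) x :=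
  (mulCLM (m := m) (n := n) (p := p)).isBoundedBilinearMap.contDiff.contDiffAt.comp x
    (ha.prodMk hb)

theorem contDiffAt_inv {A : Matrix (Fin k) (Fin k) ℝ} (hA : IsUnit A.det) {r : WithTop ℕ∞} :
    ContDiffAt ℝ r (fun B : Matrix (Fin k) (Fin k) ℝ => B⁻¹) A := by
  let := Matrix.frobeniusNormedRing (m := Fin k) (α := ℝ)
  let := Matrix.frobeniusNormedAlgebra (m := Fin k) (α := ℝ) (R := ℝ)
  obtain ⟨u, rfl⟩ := (isUnit_iff_isUnit_det A).2 hA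
  have h := contDiffAt_ringInverse ℝ (n := r) u
  have e : (fun B : Matrix (Fin k) (Fin k) ℝ => B⁻¹) = Ring.inverse := by
    ext1 B; exact nonsing_inv_eq_ringInverse B
  rw [e]
  exact h

theorem continuous_mul_mul (A : Matrix (Fin p) (Fin m) ℝ) (B : Matrix (Fin n) (Fin k) ℝ) :
    Continuous fun X : Matrix (Fin m) (Fin n) ℝ => A * X * B := by
  have h : ContDiff ℝ 0 fun X : Matrix (Fin m) (Fin n) ℝ => A * X * B :=
    contDiff_iff_contDiffAt.2 fun x =>
      contDiffAt_mul (contDiffAt_mul contDiffAt_const contDiffAt_id) contDiffAt_const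
  exact h.continuous

theorem eventually_isUnit_det {X : Matrix (Fin m) (Fin n) ℝ} {U : Matrix (Fin m) (Fin k) ℝ}
    {V : Matrix (Fin n) (Fin k) ℝ} (h : IsUnit (Uᵀ * X * V).det) :
    ∀ᶠ Y in 𝓝 X, IsUnit (Uᵀ * Y * V).det := by
  have hdet : Continuous fun A : Matrix (Fin k) (Fin k) ℝ => A.det :=
    Continuous.matrix_det continuous_id
  have hc := hdet.comp (continuous_mul_mul Uᵀ V)
  filter_upwards [hc.continuousAt.eventually_ne (isUnit_iff_ne_zero.1 h)] with Y hY
    using isUnit_iff_ne_zero.2 hY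

/-- The cross approximation is rational in `Y`, factors through dimension `k`, and has the same
invertible compression `Uᵀ Y V` as `Y`, so its rank is exactly `k`. -/
theorem isLocalRetraction_cross {X : Matrix (Fin m) (Fin n) ℝ} {U : Matrix (Fin m) (Fin k) ℝ}
    {V : Matrix (Fin n) (Fin k) ℝ} (h : IsUnit (Uᵀ * X * V).det) :
    IsLocalRetraction (fixedRank m n k)
      (fun Y : Matrix (Fin m) (Fin n) ℝ => Y * V * (Uᵀ * Y * V)⁻¹ * (Uᵀ * Y)) X where
  contDiffAt := by
    have h1 : ContDiffAt ℝ 2 (fun Y : Matrix (Fin m) (Fin n) ℝ => Uᵀ * Y) X :=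
      contDiffAt_mul contDiffAt_const contDiffAt_id
    have h2 : ContDiffAt ℝ 2 (fun Y : Matrix (Fin m) (Fin n) ℝ => Uᵀ * Y * V) X :=
      contDiffAt_mul h1 contDiffAt_const
    exact contDiffAt_mul (contDiffAt_mul (contDiffAt_mul contDiffAt_id contDiffAt_const)
      ((contDiffAt_inv h).comp X h2)) h1
  mem := by
    filter_upwards [eventually_isUnit_det h] with Y hY
    refine le_antisymm ?_ (le_rank_of_isUnit_det (U := U) (V := V) ?_)
    · exact (rank_mul_le_right _ _).trans ((rank_le_card_height _).trans_eq (Fintype.card_fin k))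
    · have : Uᵀ * (Y * V * (Uᵀ * Y * V)⁻¹ * (Uᵀ * Y)) * V =
          (Uᵀ * Y * V) * (Uᵀ * Y * V)⁻¹ * (Uᵀ * Y * V) := by simp only [Matrix.mul_assoc]
      rw [this, mul_nonsing_inv _ hY, Matrix.one_mul]
      exact hY
  eq_self := by
    filter_upwards [eventually_isUnit_det h] with Y hY hr using eq_cross_of_rank hY hr

/-- Tangent vectors to the matrices of rank `k` have no component in the product of the
orthogonal complements of the column and row space. -/
theorem tangent_block_eq_zero {X : Matrix (Fin m) (Fin n) ℝ} {U : Matrix (Fin m) (Fin k) ℝ}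
    {V : Matrix (Fin n) (Fin k) ℝ} (hr : X.rank = k)
    (hXU : projU n U X = X) (hXV : projV m V X = X) {ζ : Matrix (Fin m) (Fin n) ℝ}
    (hζ : ζ ∈ tangentSpaceAt (fixedRank m n k) X) :
    projU n U (ζ - projV m V ζ) = ζ - projV m V ζ := by
  have hdet : IsUnit (Uᵀ * X * V).det := by
    refine isUnit_det_of_rank (U := U) (V := V) ?_ hr
    conv_lhs => rw [← hXV, ← hXU, projU_apply, projV_apply]
    simp only [Matrix.mul_assoc]
  have hρ := isLocalRetraction_cross hdet
  set ρ := fun Y : Matrix (Fin m) (Fin n) ℝ => Y * V * (Uᵀ * Y * V)⁻¹ * (Uᵀ * Y) with hρdef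
  have hζ' := hρ.fderiv_eq_self hr hζ
  set I := ContinuousLinearMap.id ℝ (Matrix (Fin m) (Fin n) ℝ)
  set K := (I - projU n U).comp (I - projV m V) with hK
  have h1 : HasFDerivAt (fun Y => K (ρ Y)) (K.comp (fderiv ℝ ρ X)) X :=
    K.hasFDerivAt.comp X hρ.hasFDerivAt
  -- `K` kills `X` from either side, so `K (ρ Y)` contains `Y - X` twice and its derivative at `X`
  -- vanishes. That derivative sends a tangent `ζ` to `K ζ`.
  have hKρ : ∀ Y, K (ρ Y) = ((1 - U * Uᵀ) * (Y - X) * V) * (Uᵀ * Y * V)⁻¹ *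
      (Uᵀ * (Y - X) * (1 - V * Vᵀ)) := by
    intro Y
    have e1 : (1 - U * Uᵀ) * X = 0 := by
      rw [Matrix.sub_mul, Matrix.one_mul, sub_eq_zero]
      exact hXU.symm
    have e2 : X * (1 - V * Vᵀ) = 0 := by
      rw [Matrix.mul_sub, Matrix.mul_one, sub_eq_zero]
      exact hXV.symm
    have e3 : K (ρ Y) = (1 - U * Uᵀ) * (ρ Y * (1 - V * Vᵀ)) := by
      simp [hK, I, projU_apply, projV_apply, Matrix.sub_mul, Matrix.mul_sub]
    rw [e3, Matrix.mul_sub (1 - U * Uᵀ), e1, sub_zero, Matrix.mul_assoc Uᵀ (Y - X),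
      Matrix.sub_mul Y X, e2, sub_zero]
    simp only [hρdef, Matrix.mul_assoc]
  have h2 : HasFDerivAt (fun Y => K (ρ Y))
      (0 : Matrix (Fin m) (Fin n) ℝ →L[ℝ] Matrix (Fin m) (Fin n) ℝ) X := by
    refine Asymptotics.IsBigO.hasFDerivAt (n := 2) ?_ (by norm_num)
    have hinv : ContinuousAt (fun Y : Matrix (Fin m) (Fin n) ℝ => (Uᵀ * Y * V)⁻¹) X :=
      ((contDiffAt_inv (r := 0) hdet).continuousAt).comp (f := fun Y => Uᵀ * Y * V)
        (continuous_mul_mul Uᵀ V).continuousAt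
    refine Asymptotics.IsBigO.of_bound (‖1 - U * Uᵀ‖ * ‖V‖ * (‖(Uᵀ * X * V)⁻¹‖ + 1) *
      (‖Uᵀ‖ * ‖1 - V * Vᵀ‖)) ?_
    filter_upwards [hinv.norm.eventually_lt_const (lt_add_one _)] with Y hY
    rw [hKρ, Real.norm_of_nonneg (by positivity)]
    calc _ ≤ ‖(1 - U * Uᵀ) * (Y - X) * V‖ * ‖(Uᵀ * Y * V)⁻¹‖ * ‖Uᵀ * (Y - X) * (1 - V * Vᵀ)‖ :=
          (frobenius_norm_mul _ _).trans (by gcongr; exact frobenius_norm_mul _ _)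
      _ ≤ (‖1 - U * Uᵀ‖ * ‖Y - X‖ * ‖V‖) * (‖(Uᵀ * X * V)⁻¹‖ + 1) *
          (‖Uᵀ‖ * ‖Y - X‖ * ‖1 - V * Vᵀ‖) := by
          gcongr
          · exact (frobenius_norm_mul _ _).trans (by gcongr; exact frobenius_norm_mul _ _)
          · exact (frobenius_norm_mul _ _).trans (by gcongr; exact frobenius_norm_mul _ _)
      _ = _ := by ring
  have h3 := DFunLike.congr_fun (h1.unique h2) ζ
  rw [ContinuousLinearMap.comp_apply, hζ'] at h3
  exact (sub_eq_zero.1 h3).symm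

theorem projU_projV_comm (U : Matrix (Fin m) (Fin k) ℝ) (V : Matrix (Fin n) (Fin k) ℝ)
    (Z : Matrix (Fin m) (Fin n) ℝ) : projU n U (projV m V Z) = projV m V (projU n U Z) := by
  simp only [projU_apply, projV_apply, Matrix.mul_assoc]

theorem tangent_block_eq_zero' {X : Matrix (Fin m) (Fin n) ℝ} {U : Matrix (Fin m) (Fin k) ℝ}
    {V : Matrix (Fin n) (Fin k) ℝ} (hr : X.rank = k)
    (hXU : projU n U X = X) (hXV : projV m V X = X) {ζ : Matrix (Fin m) (Fin n) ℝ}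
    (hζ : ζ ∈ tangentSpaceAt (fixedRank m n k) X) :
    projV m V (ζ - projU n U ζ) = ζ - projU n U ζ := by
  have h := tangent_block_eq_zero hr hXU hXV hζ
  rw [map_sub, projU_projV_comm] at h
  rw [map_sub]
  rw [← sub_eq_zero] at h ⊢
  exact Eq.trans (by abel) h

/-- A tangent vector splits into a part in the range of `projV` and one in the range of `projU`,
both orthogonal to the gradient. -/
theorem riemannianGradient_fixedRank_eq_zero {f : Matrix (Fin m) (Fin n) ℝ → ℝ}
    {X : Matrix (Fin m) (Fin n) ℝ} {U : Matrix (Fin m) (Fin k) ℝ}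
    {V : Matrix (Fin n) (Fin k) ℝ} (hr : X.rank = k)
    (hXU : projU n U X = X) (hXV : projV m V X = X)
    (hU : projU n U (gradient f X) = 0) (hV : projV m V (gradient f X) = 0) :
    riemannianGradient (fixedRank m n k) f X = 0 := by
  set ζ := riemannianGradient (fixedRank m n k) f X with hζ
  have hm : ζ ∈ tangentSpaceAt (fixedRank m n k) X := Submodule.starProjection_apply_mem _ _
  have h1 := tangent_block_eq_zero hr hXU hXV hm
  have h2 : ζ = projV m V ζ + projU n U (ζ - projV m V ζ) := by rw [h1]; abel
  have h3 : inner ℝ ζ ζ = (0 : ℝ) := by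
    conv_lhs => rw [hζ, inner_riemannianGradient hm, h2, inner_add_right, ← projV_symm,
      ← projU_symm, hU, hV, inner_zero_left, inner_zero_left, add_zero]
  exact inner_self_eq_zero.1 h3

theorem rank_le_of_projV {X : Matrix (Fin m) (Fin n) ℝ} {V : Matrix (Fin n) (Fin k) ℝ}
    (h : projV m V X = X) : X.rank ≤ k := by
  rw [← h, projV_apply]
  exact (rank_mul_le_right _ _).trans ((rank_mul_le_left _ _).trans
    ((rank_le_card_width _).trans_eq (Fintype.card_fin k)))

theorem rank_le_of_projU {X : Matrix (Fin m) (Fin n) ℝ} {U : Matrix (Fin m) (Fin k) ℝ}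
    (h : projU n U X = X) : X.rank ≤ k := by
  rw [← h, projU_apply]
  exact (rank_mul_le_left _ _).trans ((rank_mul_le_left _ _).trans
    ((rank_le_card_width _).trans_eq (Fintype.card_fin k)))

theorem eventually_mem_fixedRank {X : Matrix (Fin m) (Fin n) ℝ} {U : Matrix (Fin m) (Fin k) ℝ}
    {V : Matrix (Fin n) (Fin k) ℝ} (h : IsUnit (Uᵀ * X * V).det) :
    ∀ᶠ Y in 𝓝 X, Y.rank ≤ k → Y ∈ fixedRank m n k := by
  filter_upwards [eventually_isUnit_det h] with Y hY hr using le_antisymm hr (le_rank_of_isUnit_det hY)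

/-! ### Alternating least squares as subspace minimization. -/

/-- The iterates of alternating least squares, together with the intermediate iterates after the
first minimization of each step, minimize `f` over a sequence of subspaces. -/
theorem IsALS.exists_subspaceMinimization {f : Matrix (Fin m) (Fin n) ℝ → ℝ}
    {U : ℕ → Matrix (Fin m) (Fin k) ℝ} {V : ℕ → Matrix (Fin n) (Fin k) ℝ} (h : IsALS f U V) :
    ∃ (A : ℕ → Matrix (Fin m) (Fin k) ℝ) (B : ℕ → Matrix (Fin n) (Fin k) ℝ)
      (z : ℕ → Matrix (Fin m) (Fin n) ℝ),
      (∀ i, (A i)ᵀ * A i = 1) ∧ (∀ i, (B i)ᵀ * B i = 1) ∧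
      (∀ i, z (2 * i) = U i * (V i)ᵀ) ∧
      IsSubspaceMinimization f
        (fun j => if Even j then projV m (B (j / 2)) else projU n (A (j / 2))) z := by
  choose B W hB hW hA hV using h
  set z : ℕ → Matrix (Fin m) (Fin n) ℝ := fun j =>
    if Even j then U (j / 2) * (V (j / 2))ᵀ else W (j / 2) * (B (j / 2))ᵀ with hz
  have z0 : ∀ i, z (2 * i) = U i * (V i)ᵀ := by intro i; simp [hz]
  have z1 : ∀ i, z (2 * i + 1) = W i * (B i)ᵀ := by
    intro i
    have : (2 * i + 1) / 2 = i := by omega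
    simp [hz, this]
  have z2 : ∀ i, z (2 * i + 1 + 1) = U (i + 1) * (V (i + 1))ᵀ := fun i => z0 (i + 1)
  refine ⟨fun i => U (i + 1), B, z, fun i => (hA i).1, fun i => (hB i).1, z0, ?_⟩
  set P : ℕ → Matrix (Fin m) (Fin n) ℝ →L[ℝ] Matrix (Fin m) (Fin n) ℝ :=
    fun j => if Even j then projV m (B (j / 2)) else projU n (U (j / 2 + 1)) with hP
  have p0 : ∀ i, P (2 * i) = projV m (B i) := by intro i; simp [hP]
  have p1 : ∀ i, P (2 * i + 1) = projU n (U (i + 1)) := by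
    intro i
    have : (2 * i + 1) / 2 = i := by omega
    simp [hP, this]
  have hBB : ∀ i (Y : Matrix (Fin m) (Fin k) ℝ), Y * (B i)ᵀ * (B i * (B i)ᵀ) = Y * (B i)ᵀ := by
    intro i Y
    rw [Matrix.mul_assoc, ← Matrix.mul_assoc (B i)ᵀ, (hB i).1, Matrix.one_mul]
  have hUU : ∀ i (Y : Matrix (Fin k) (Fin n) ℝ),
      U (i + 1) * (U (i + 1))ᵀ * (U (i + 1) * Y) = U (i + 1) * Y := by
    intro i Y
    rw [Matrix.mul_assoc, ← Matrix.mul_assoc (U (i + 1))ᵀ, (hA i).1, Matrix.one_mul]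
  constructor
  · intro j v
    obtain ⟨i, rfl | rfl⟩ := Nat.even_or_odd' j
    · rw [p0]; exact projV_idem (hB i).1 v
    · rw [p1]; exact projU_idem (hA i).1 v
  · intro j v w
    obtain ⟨i, rfl | rfl⟩ := Nat.even_or_odd' j
    · rw [p0]; exact projV_symm _ _ _
    · rw [p1]; exact projU_symm _ _ _
  · intro j
    obtain ⟨i, rfl | rfl⟩ := Nat.even_or_odd' j
    -- `V i = B i * R` puts the current point into the next search space; this covers the arbitrary
    -- start `i = 0` too.
    · obtain ⟨R, -, hR⟩ := (hB i).2
      rw [p0, z0, projV_apply]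
      conv_lhs => rw [hR, transpose_mul, ← Matrix.mul_assoc (U i), hBB]
      conv_rhs => rw [hR, transpose_mul, ← Matrix.mul_assoc (U i)]
    · obtain ⟨R, -, hR⟩ := (hA i).2
      rw [p1, z1, projU_apply, hR, Matrix.mul_assoc (U (i + 1)) R, hUU]
  · intro j
    obtain ⟨i, rfl | rfl⟩ := Nat.even_or_odd' j
    · rw [p0, z1, projV_apply, hBB]
    · rw [p1, z2, projU_apply, hUU]
  · intro j w hw
    obtain ⟨i, rfl | rfl⟩ := Nat.even_or_odd' j
    · rw [p0, projV_apply, ← Matrix.mul_assoc] at hw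
      rw [z1, ← hw]
      exact hW i _
    · rw [p1, projU_apply, Matrix.mul_assoc] at hw
      rw [z2, ← hw]
      simpa using hV i ((U (i + 1))ᵀ * w)ᵀ

theorem mem_tangentSpaceAt_of_line {E : Type*} [NormedAddCommGroup E] [InnerProductSpace ℝ E]
    {M : Set E} {x ξ : E} (h : ∀ᶠ t : ℝ in 𝓝 0, x + t • ξ ∈ M) : ξ ∈ tangentSpaceAt M x :=
  Submodule.subset_span (mem_tangentConeAt_of_add_smul_mem (l := 𝓝[≠] (0 : ℝ)) (c := id) tendsto_id
    (h.filter_mono nhdsWithin_le_nhds))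

end MatrixFacts
end LowRank

/-! ### Assembly for alternating least squares. -/

theorem mainTheorem8 {m n k : ℕ} (hk : 0 < k) (hkm : k < m) (hkn : k < n)
    (f : Matrix (Fin m) (Fin n) ℝ → ℝ) (lam : ℝ)
    (hsmooth : LowRank.IsSmooth lam f) (hconv : LowRank.IsStronglyConvex f)
    (U : ℕ → Matrix (Fin m) (Fin k) ℝ) (V : ℕ → Matrix (Fin n) (Fin k) ℝ)
    (hALS : LowRank.IsALS f U V)
    (X : ℕ → Matrix (Fin m) (Fin n) ℝ) (hX : ∀ ℓ, X ℓ = U ℓ * (V ℓ).transpose)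
    (Xs : Matrix (Fin m) (Fin n) ℝ) (hacc : MapClusterPt Xs atTop X) (hrank : Xs.rank = k)
    (hC2 : ContDiffAt ℝ 2 f Xs)
    (hpos : LowRank.IsPosDef (LowRank.riemannianHessian (LowRank.fixedRank m n k) f Xs))
    (Us : Matrix (Fin m) (Fin k) ℝ) (Ss : Matrix (Fin k) (Fin k) ℝ)
    (Vs : Matrix (Fin n) (Fin k) ℝ)
    (hUs : Us.transpose * Us = 1) (hVs : Vs.transpose * Vs = 1)
    (hXs : Xs = Us * Ss * Vs.transpose) :
    Tendsto X atTop (𝓝 Xs) ∧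
    LowRank.IsIsolatedLocalMinOn f (LowRank.fixedRank m n k) Xs ∧
    (∀ ℓ, f Xs ≤ f (X ℓ)) ∧
    ∃ lmin : ℝ,
      IsLeast {μ : ℝ | Module.End.HasEigenvalue
        (LowRank.riemannianHessian (LowRank.fixedRank m n k) f Xs) μ} lmin ∧
      limsup (fun ℓ : ℕ => ((‖X ℓ - Xs‖ ^ (1 / (ℓ : ℝ)) : ℝ) : EReal)) atTop ≤
        ((1 - lmin / LowRank.projectedHessianNorm f Us Vs Xs : ℝ) : EReal) ∧
      1 - lmin / LowRank.projectedHessianNorm f Us Vs Xs < 1 ∧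
      limsup (fun ℓ : ℕ => (((f (X ℓ) - f Xs) ^ (1 / (ℓ : ℝ)) : ℝ) : EReal)) atTop ≤
        (((1 - lmin / LowRank.projectedHessianNorm f Us Vs Xs) ^ 2 : ℝ) : EReal) := by
  have hdetS : IsUnit Ss.det := LowRank.isUnit_det_of_rank hXs hrank
  have hdet : IsUnit (Us.transpose * Xs * Vs).det := by
    have : Us.transpose * Xs * Vs = (Us.transpose * Us) * Ss * (Vs.transpose * Vs) := by
      rw [hXs]; simp only [Matrix.mul_assoc]
    rwa [this, hUs, hVs, Matrix.one_mul, Matrix.mul_one]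
  have hXV : LowRank.projV m Vs Xs = Xs := by
    rw [LowRank.projV_apply, hXs, Matrix.mul_assoc _ Vs.transpose, ← Matrix.mul_assoc Vs.transpose,
      hVs, Matrix.one_mul]
  have hXU : LowRank.projU n Us Xs = Xs := by
    rw [LowRank.projU_apply, hXs, Matrix.mul_assoc Us Ss, Matrix.mul_assoc Us,
      ← Matrix.mul_assoc Us.transpose, hUs, Matrix.one_mul]
  have hf := hsmooth.2.1
  have hρ := LowRank.isLocalRetraction_cross hdet
  have hmem : Xs ∈ LowRank.fixedRank m n k := hrank
  -- A nonzero direction (as `0 < k`) that keeps the row space, so the line through `Xs` has rank at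
  -- most `k`, and exactly `k` near `Xs`. It makes the tangent space nontrivial and gives `l ≤ Λ`.
  set ξ : Matrix (Fin m) (Fin n) ℝ := Us * Vs.transpose with hξdef
  have hξV : LowRank.projV m Vs ξ = ξ := by
    rw [LowRank.projV_apply, hξdef, Matrix.mul_assoc, ← Matrix.mul_assoc Vs.transpose, hVs,
      Matrix.one_mul]
  have hξ0 : ξ ≠ 0 := by
    intro h
    have h1 : Us.transpose * ξ * Vs = 1 := by
      rw [hξdef, ← Matrix.mul_assoc, hUs, Matrix.one_mul, hVs]
    rw [h, Matrix.mul_zero, Matrix.zero_mul] at h1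
    have : (0 : Matrix (Fin k) (Fin k) ℝ) ⟨0, hk⟩ ⟨0, hk⟩ = 1 := by rw [h1, Matrix.one_apply_eq]
    simp at this
  have hline : ∀ᶠ t : ℝ in 𝓝 0, Xs + t • ξ ∈ LowRank.fixedRank m n k := by
    have hc : Tendsto (fun t : ℝ => Xs + t • ξ) (𝓝 0) (𝓝 Xs) := by
      have : Continuous (fun t : ℝ => Xs + t • ξ) := by fun_prop
      simpa using this.tendsto 0
    filter_upwards [hc.eventually (LowRank.eventually_mem_fixedRank hdet)] with t ht
    exact ht (LowRank.rank_le_of_projV (V := Vs) (by rw [map_add, map_smul, hXV, hξV]))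
  have hξT := LowRank.mem_tangentSpaceAt_of_line hline
  have : Nontrivial (LowRank.tangentSpaceAt (LowRank.fixedRank m n k) Xs) :=
    ⟨⟨⟨ξ, hξT⟩, 0, fun h => hξ0 (congrArg Subtype.val h)⟩⟩
  have hD := LowRank.differentiableWithinAt_of_isPosDef hpos
  obtain ⟨A, B, z, hA, hB, hz, hs⟩ := hALS.exists_subspaceMinimization
  set P : ℕ → Matrix (Fin m) (Fin n) ℝ →L[ℝ] Matrix (Fin m) (Fin n) ℝ :=
    fun j => if Even j then LowRank.projV m (B (j / 2)) else LowRank.projU n (A (j / 2)) with hP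
  set S : ℕ → Matrix (Fin m) (Fin n) ℝ →L[ℝ] Matrix (Fin m) (Fin n) ℝ :=
    fun j => if Even j then LowRank.projV m Vs else LowRank.projU n Us with hSdef
  have p0 : ∀ j, Even j → P j = LowRank.projV m (B (j / 2)) := fun j hj => by simp [hP, hj]
  have p1 : ∀ j, ¬ Even j → P j = LowRank.projU n (A (j / 2)) := fun j hj => by simp [hP, hj]
  have s0 : ∀ j, Even j → S j = LowRank.projV m Vs := fun j hj => by simp [hSdef, hj]
  have s1 : ∀ j, ¬ Even j → S j = LowRank.projU n Us := fun j hj => by simp [hSdef, hj]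
  have hXz : ∀ ℓ, X ℓ = z (2 * ℓ) := fun ℓ => by rw [hX, hz]
  obtain ⟨C, hS⟩ : ∃ C : ℝ, ∀ j, ‖P j - S j‖ ≤ C * ‖z j - Xs‖ := by
    obtain ⟨C₁, h₁⟩ := LowRank.exists_norm_projV_sub_le hUs hVs hdetS
    obtain ⟨C₂, h₂⟩ := LowRank.exists_norm_projU_sub_le hUs hVs hdetS
    rw [← hXs] at h₁ h₂
    refine ⟨max C₁ C₂, fun j => ?_⟩
    have hl := hs.left j
    by_cases hj : Even j
    · rw [p0 j hj] at hl ⊢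
      rw [s0 j hj]
      exact (h₁ _ _ (hB _) hl).trans (by gcongr; exact le_max_left _ _)
    · rw [p1 j hj] at hl ⊢
      rw [s1 j hj]
      exact (h₂ _ _ (hA _) hl).trans (by gcongr; exact le_max_right _ _)
  obtain ⟨ψ, hψ, hψX⟩ := hacc.tendsto_subseq
  have hφ : Tendsto (fun i => 2 * ψ i) atTop atTop :=
    hψ.tendsto_atTop.const_mul_atTop' (by norm_num)
  have hφz : Tendsto (z ∘ fun i => 2 * ψ i) atTop (𝓝 Xs) := by
    refine hψX.congr fun i => ?_
    exact hXz _
  have hstep := hs.tendsto_step hf hconv hφ hφz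
  -- Vanishing steps make the intermediate iterates cluster at `Xs` too, which supplies the `projU`
  -- half of criticality.
  have hφ' : Tendsto (fun i => 2 * ψ i + 1) atTop atTop := (tendsto_add_atTop_nat 1).comp hφ
  have hφz' : Tendsto (z ∘ fun i => 2 * ψ i + 1) atTop (𝓝 Xs) := by
    have := (hstep.comp hφ).add hφz
    rw [zero_add] at this
    refine this.congr fun i => ?_
    simp
  have hgV : LowRank.projV m Vs (gradient f Xs) = 0 :=
    hs.critical_of_cluster hsmooth hstep hφ hφz hS fun i => s0 _ (by simp)
  have hgU : LowRank.projU n Us (gradient f Xs) = 0 :=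
    hs.critical_of_cluster hsmooth hstep hφ' hφz' hS fun i => s1 _ (by simp)
  have h0 := LowRank.riemannianGradient_fixedRank_eq_zero hrank hXU hXV hgU hgV
  obtain ⟨l, hl, hleast, hH⟩ := LowRank.exists_isLeast_eigenvalue
    (LowRank.riemannianHessian_isSymmetric hρ hmem hf hC2 h0 hD) hpos
  set Λ := LowRank.projectedHessianNorm f Us Vs Xs with hΛdef
  have hSB : ∀ j v, fderiv ℝ (fderiv ℝ f) Xs (S j v) (S j v) ≤ Λ * ‖v‖ ^ 2 := by
    intro j v
    by_cases hj : Even j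
    · rw [s0 j hj]
      refine (LowRank.fderiv_fderiv_le_opNorm hC2 (LowRank.projV_symm Vs) v).trans ?_
      gcongr
      exact le_max_left _ _
    · rw [s1 j hj]
      refine (LowRank.fderiv_fderiv_le_opNorm hC2 (LowRank.projU_symm Us) v).trans ?_
      gcongr
      exact le_max_right _ _
  have hlΛ : l ≤ Λ := by
    refine LowRank.le_of_line_mem hf hC2 hρ hmem h0 hD hH hξ0 hξT hline ?_
    have := hSB 0 ξ
    rwa [s0 0 (by simp), hξV] at this
  have hΛ : 0 < Λ := hl.trans_le hlΛ
  have hgrow := LowRank.local_growth hρ hmem hf hC2 h0 hD hl hH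
  have hrk : ∀ j, (z j).rank ≤ k := by
    intro j
    have h1 := hs.left j
    by_cases hj : Even j
    · rw [p0 j hj] at h1
      exact LowRank.rank_le_of_projV h1
    · rw [p1 j hj] at h1
      exact LowRank.rank_le_of_projU h1
  have hev := LowRank.eventually_mem_fixedRank hdet
  have hzlim : Tendsto z atTop (𝓝 Xs) := by
    refine hs.tendsto_of_growth hf.continuous hstep hφ hφz (by positivity : 0 < l / 16) hgrow ?_
    filter_upwards [hev] with x hx
    rintro ⟨j, rfl⟩
    exact hx (hrk j)
  have hM : ∀ᶠ j in atTop, z j ∈ LowRank.fixedRank m n k := by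
    filter_upwards [hzlim.eventually hev] with j hj using hj (hrk j)
  have hle := hs.le_value hf.continuous hφ hφz
  have hT : ∀ᶠ j in atTop, ∀ ζ ∈ LowRank.tangentSpaceAt (LowRank.fixedRank m n k) (z (j + 1)),
      P j (ζ - P (j + 1) ζ) = ζ - P (j + 1) ζ := by
    filter_upwards [(tendsto_add_atTop_nat 1).eventually hM] with j hj ζ hζ
    have h1 := hs.right j
    have h2 := hs.left (j + 1)
    by_cases he : Even j
    · have he' : ¬ Even (j + 1) := by rwa [Nat.even_add_one, not_not]
      rw [p0 j he] at h1 ⊢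
      rw [p1 _ he'] at h2 ⊢
      exact LowRank.tangent_block_eq_zero' hj h2 h1 hζ
    · have he' : Even (j + 1) := by rwa [Nat.even_add_one]
      rw [p1 j he] at h1 ⊢
      rw [p0 _ he'] at h2 ⊢
      exact LowRank.tangent_block_eq_zero hj h1 h2 hζ
  have hlims := LowRank.limsup_le_of_contraction hlΛ hΛ hle (by positivity : 0 < l / 16)
    ((tendsto_nhdsWithin_iff.2 ⟨hzlim, hM⟩).eventually hgrow) fun θ hθ =>
      hs.eventually_contraction hf hC2 hρ hmem h0 hD hH hl hΛ hzlim hle hS hSB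
        (hs.tendsto_proj_gradient hsmooth hstep) hM hT hθ
  obtain rfl : X = fun ℓ => z (2 * ℓ) := funext hXz
  refine ⟨hzlim.comp (tendsto_id.const_mul_atTop' (by norm_num)),
    LowRank.isIsolatedLocalMinOn_of_hessian hρ hmem hf hC2 h0 hD hl hH, fun ℓ => hle _, l, hleast,
    hlims.1, ?_, hlims.2⟩
  have : 0 < l / Λ := by positivity
  linarith
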